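/- **Conventions.** A DGCA is a commutative differential graded cochain algebra $(A,\partial)$ over $\mathbb{Q}$, $A=\bigoplus_{n\ge 0}A^n$, with $\partial$ of degree $+1$, $\partial^2=0$, $\partial(ab)=(\partial a)b+(-1)^{\deg a}a\,\partial b$ and $ab=(-1)^{\deg a\deg b}ba$. It is *path-connected* if $\mathrm H^0(A)\cong\mathbb{Q}$ and *simply-connected* if moreover $\mathrm H^1(A)=0$. Let $\mathbf{CDGA}$ be the category of path-connected DGCAs, with degree-preserving algebra homomorphisms commuting with $\partial$ as morphisms; let $\mathbf{GVec}$ be the category of $\mathbb{N}$-graded $\mathbb{Q}$-vector spaces and degree-$0$ linear maps, and $\mathrm H:\mathbf{CDGA}\to\mathbf{GVec}$ the cohomology functor. Let $\mathbf{Ho}(\mathbf{CDGA})$ be the localization of $\mathbf{CDGA}$ at the quasi-isomorphisms (the morphisms inducing an isomorphism on cohomology). A *persistent object* in a category $\mathcal C$ is a functor $F_\bullet:(\mathbb{R},\le)\to\mathcal C$. For $\delta\ge 0$, persistent objects $F_\bullet,G_\bullet$ are *$\delta$-interleaved* if there are morphisms $\varphi_t:F_t\to G_{t+\delta}$ and $\psi_t:G_t\to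 F_{t+\delta}$ ($t\in\mathbb{R}$), commuting with the structure maps, such that $\psi_{t+\delta}\circ\varphi_t$ and $\varphi_{t+\delta}\circ\psi_t$ are the structure maps $F_t\to F_{t+2\delta}$ and $G_t\to G_{t+2\delta}$ for all $t$. Put $d_{\mathrm I}^{\mathcal C}(F_\bullet,G_\bullet)=\inf\{\delta\ge 0: F_\bullet,G_\bullet \text{ are }\delta\text{-interleaved}\}\in[0,\infty]$, with $\inf\emptyset=\infty$. For persistent objects of $\mathbf{CDGA}$, $d_{\mathrm I}^{\mathbf{Ho}(\mathbf{CDGA})}$ is computed after composing with the localization functor $\mathbf{CDGA}\to\mathbf{Ho}(\mathbf{CDGA})$. A *minimal Sullivan algebra* $(\wedge V,\partial)$ is a DGCA whose underlying graded algebra is the free graded commutative algebra $\wedge V$ on a graded vector space $V=\bigoplus_{n>0}V^n$, such that $V=\bigcup_{k\ge0}V(k)$ for graded subspaces $V(0)\subseteq V(1)\subseteq\cdots$ with $\partial V(0)=0$ and $\partial V(k)\subseteq\wedge V(k-1)$ for $k\ge 1$, and such that $\operatorname{im}\partial\subseteq\wedge^+V\cdot\wedge^+V$, where $\wedge^+V$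 is the part of positive degree. A *persistent minimal Sullivan algebra* $\wedge V_\bullet$ is a functor from $(\mathbb{R},\le)$ to the full subcategory of $\mathbf{CDGA}$ on the minimal Sullivan algebras; it is simply-connected if every $\wedge V_t$ is. Its persistent graded vector space of generators $V_\bullet$ consists of the spaces $V_t$, with structure map $V_t\to V_s$ the linear part of $f_{t,s}:\wedge V_t\to\wedge V_s$, that is, the map that $f_{t,s}$ induces on indecomposables $\wedge^+V/(\wedge^+V\cdot\wedge^+V)\cong V$. **Theorem.** 1. Let $A_\bullet$ and $B_\bullet$ be persistent objects in $\mathbf{CDGA}$. Then $$d_{\mathrm I}^{\mathbf{GVec}}(\mathrm H\circ A_\bullet,\mathrm H\circ B_\bullet)\le d_{\mathrm I}^{\mathbf{Ho}(\mathbf{CDGA})}(A_\bullet,B_\bullet).$$ 2. Let $\wedge V_\bullet$ and $\wedge W_\bullet$ be simply-connected persistent minimal Sullivan algebras. Then $$d_{\mathrm I}^{\mathbf{GVec}}(V_\bullet,W_\bullet)\le d_{\mathrm I}^{\mathbf{Ho}(\mathbf{CDGA})}(\wedge V_\bullet,\wedge W_\bullet).$$ -/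

import Mathlib

open CategoryTheory
open scoped ENNReal NNReal

universe u

/-! ### Persistent objects and the interleaving distance -/

/-- A persistent object in `C`: a functor from the poset category of the reals to `C`. -/
abbrev Persistent (C : Type*) [Category C] := ℝ ⥤ C

/-- `F` and `G` are `δ`-interleaved: there are families `φ t : F t ⟶ G (t + δ)` and
`ψ t : G t ⟶ F (t + δ)` that commute with the structure maps and whose two composites are the
structure maps from `t` to `t + δ + δ`. -/
def Interleaved {C : Type*} [Category C] (F G : Persistent C) (δ : ℝ≥0) : Prop :=
  ∃ (φ : ∀ t : ℝ, F.obj t ⟶ G.obj (t + (δ : ℝ)))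
    (ψ : ∀ t : ℝ, G.obj t ⟶ F.obj (t + (δ : ℝ))),
    (∀ (t s : ℝ) (h : t ≤ s),
      F.map (homOfLE h) ≫ φ s = φ t ≫ G.map (homOfLE (add_le_add_left h (δ : ℝ)))) ∧
    (∀ (t s : ℝ) (h : t ≤ s),
      G.map (homOfLE h) ≫ ψ s = ψ t ≫ F.map (homOfLE (add_le_add_left h (δ : ℝ)))) ∧
    (∀ t : ℝ, φ t ≫ ψ (t + (δ : ℝ)) =
      F.map (homOfLE ((le_add_of_nonneg_right δ.2).trans (le_add_of_nonneg_right δ.2)))) ∧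
    (∀ t : ℝ, ψ t ≫ φ (t + (δ : ℝ)) =
      G.map (homOfLE ((le_add_of_nonneg_right δ.2).trans (le_add_of_nonneg_right δ.2))))

/-- The interleaving distance in the category `C`; the infimum of the empty set is `∞`. -/
noncomputable def interleavingDist {C : Type*} [Category C] (F G : Persistent C) : ℝ≥0∞ :=
  ⨅ (δ : ℝ≥0) (_ : Interleaved F G δ), (δ : ℝ≥0∞)

/-- Graded rational vector spaces `⨁_{n ≥ 0} Vⁿ`, with the linear maps of degree `0`. -/
abbrev GVec := GradedObject ℕ (ModuleCat.{u} ℚ)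

/-! ### Commutative differential graded algebras -/

/-- A commutative differential graded (cochain) algebra over `ℚ`, graded over `ℕ`, with a
differential of degree `+1`. -/
structure DGCA : Type (u + 1) where
  carrier : Type u
  [ring : Ring carrier]
  [algebra : Algebra ℚ carrier]
  /-- the homogeneous parts `Aⁿ` -/
  grading : ℕ → Submodule ℚ carrier
  [gradedAlgebra : GradedAlgebra grading]
  /-- the differential -/
  d : carrier →ₗ[ℚ] carrier
  d_mem : ∀ (n : ℕ) (a : carrier), a ∈ grading n → d a ∈ grading (n + 1)
  d_d : ∀ a : carrier, d (d a) = 0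
  leibniz : ∀ (n : ℕ) (a b : carrier), a ∈ grading n →
    d (a * b) = d a * b + (-1) ^ n * (a * d b)
  graded_comm : ∀ (m n : ℕ) (a b : carrier), a ∈ grading m → b ∈ grading n →
    a * b = (-1) ^ (m * n) * (b * a)

namespace DGCA

instance : CoeSort DGCA.{u} (Type u) := ⟨DGCA.carrier⟩

attribute [instance] DGCA.ring DGCA.algebra DGCA.gradedAlgebra

/-- Morphisms: algebra homomorphisms that preserve degrees and commute with differentials. -/
@[ext]
structure Hom (A B : DGCA.{u}) where
  toAlgHom : A →ₐ[ℚ] B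
  map_mem : ∀ (n : ℕ) (a : A), a ∈ A.grading n → toAlgHom a ∈ B.grading n
  map_d : ∀ a : A, toAlgHom (A.d a) = B.d (toAlgHom a)

instance : Category.{u} DGCA.{u} where
  Hom := Hom
  id A := ⟨AlgHom.id ℚ A, fun _ _ h => h, fun _ => rfl⟩
  comp f g := ⟨g.toAlgHom.comp f.toAlgHom,
    fun n a h => g.map_mem n _ (f.map_mem n a h),
    fun a => (congrArg g.toAlgHom (f.map_d a)).trans (g.map_d _)⟩

/-- The cocycles of degree `n`. -/
def cocycles (A : DGCA.{u}) (n : ℕ) : Submodule ℚ A :=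
  LinearMap.ker A.d ⊓ A.grading n

/-- The coboundaries of degree `n`, as a subspace of the cocycles of degree `n`. -/
def coboundaries (A : DGCA.{u}) (n : ℕ) : Submodule ℚ (A.cocycles n) :=
  (LinearMap.range A.d).comap (A.cocycles n).subtype

/-- The cohomology `Hⁿ(A)`. -/
abbrev cohomology (A : DGCA.{u}) (n : ℕ) : Type u :=
  A.cocycles n ⧸ A.coboundaries n

/-- The map that a morphism induces on cocycles. -/
def cocyclesMap {A B : DGCA.{u}} (f : A ⟶ B) (n : ℕ) : A.cocycles n →ₗ[ℚ] B.cocycles n :=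
  f.toAlgHom.toLinearMap.restrict (p := A.cocycles n) (q := B.cocycles n) (fun a ha =>
    ⟨by
      have h : A.d a = 0 := ha.1
      change B.d (f.toAlgHom a) = 0
      rw [← f.map_d, h, map_zero], f.map_mem n a ha.2⟩)

/-- The map that a morphism induces on cohomology. -/
def cohomologyMap {A B : DGCA.{u}} (f : A ⟶ B) (n : ℕ) :
    A.cohomology n →ₗ[ℚ] B.cohomology n :=
  Submodule.mapQ _ _ (cocyclesMap f n) (by
    rintro ⟨a, ha⟩ ⟨b, hb⟩
    exact ⟨f.toAlgHom b, by rw [← f.map_d, hb]; rfl⟩)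

/-- The cohomology functor `H` to graded vector spaces. -/
def cohomologyFunctor : DGCA.{u} ⥤ GVec.{u} where
  obj A := fun n => ModuleCat.of ℚ (A.cohomology n)
  map f := fun n => ModuleCat.ofHom (cohomologyMap f n)
  map_id A := by
    funext n
    apply ModuleCat.hom_ext
    apply LinearMap.ext
    intro x
    induction x using Submodule.Quotient.induction_on with
    | H x => rfl
  map_comp f g := by
    funext n
    apply ModuleCat.hom_ext
    apply LinearMap.ext
    intro x
    induction x using Submodule.Quotient.induction_on with
    | H x => rfl

/-- `A` is path-connected: `H⁰(A) = ℚ`. -/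
def IsPathConnected : ObjectProperty DGCA.{u} := fun A =>
  Nonempty (A.cohomology 0 ≃ₗ[ℚ] ℚ)

/-- `A` is simply-connected: `H⁰(A) = ℚ` and `H¹(A) = 0`. -/
def IsSimplyConnected (A : DGCA.{u}) : Prop :=
  A.IsPathConnected ∧ Subsingleton (A.cohomology 1)

/-- The positive-degree part `A⁺ = ⨁_{n > 0} Aⁿ`. -/
def plus (A : DGCA.{u}) : Submodule ℚ A := ⨆ n : ℕ, A.grading (n + 1)

/-- The degree `n` part of the space of indecomposables `A⁺ / (A⁺ · A⁺)`. -/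
abbrev indec (A : DGCA.{u}) (n : ℕ) : Type u :=
  ↥(A.grading n ⊓ A.plus) ⧸ (A.plus * A.plus).comap (A.grading n ⊓ A.plus).subtype

theorem map_plus {A B : DGCA.{u}} (f : A ⟶ B) {a : A} (ha : a ∈ A.plus) :
    f.toAlgHom a ∈ B.plus := by
  have h : A.plus ≤ B.plus.comap f.toAlgHom.toLinearMap :=
    iSup_le fun n x hx =>
      (le_iSup (fun n : ℕ => B.grading (n + 1)) n) (f.map_mem _ x hx)
  exact h ha

theorem map_plus_mul_plus {A B : DGCA.{u}} (f : A ⟶ B) {a : A} (ha : a ∈ A.plus * A.plus) :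
    f.toAlgHom a ∈ B.plus * B.plus := by
  have h : A.plus * A.plus ≤ (B.plus * B.plus).comap f.toAlgHom.toLinearMap := by
    rw [Submodule.mul_le]
    intro x hx y hy
    change f.toAlgHom (x * y) ∈ B.plus * B.plus
    rw [map_mul]
    exact Submodule.mul_mem_mul (M := B.plus) (N := B.plus) (map_plus f hx) (map_plus f hy)
  exact h ha

/-- The linear part of a morphism: the map that it induces on indecomposables. -/
def indecMap {A B : DGCA.{u}} (f : A ⟶ B) (n : ℕ) : A.indec n →ₗ[ℚ] B.indec n :=
  Submodule.mapQ _ _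
    (f.toAlgHom.toLinearMap.restrict (p := A.grading n ⊓ A.plus) (q := B.grading n ⊓ B.plus)
      (fun a ha => ⟨f.map_mem n a ha.1, map_plus f ha.2⟩))
    (fun _ ha => map_plus_mul_plus f ha)

theorem indecMap_id (A : DGCA.{u}) (n : ℕ) : indecMap (𝟙 A) n = LinearMap.id := by
  apply LinearMap.ext
  intro x
  induction x using Submodule.Quotient.induction_on with
  | H x => rfl

theorem indecMap_comp {A B C : DGCA.{u}} (f : A ⟶ B) (g : B ⟶ C) (n : ℕ) :
    indecMap (f ≫ g) n = (indecMap g n).comp (indecMap f n) := by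
  apply LinearMap.ext
  intro x
  induction x using Submodule.Quotient.induction_on with
  | H x => rfl

theorem plus_mul_plus_le (A : DGCA.{u}) : A.plus * A.plus ≤ A.plus := by
  rw [Submodule.mul_le]
  intro x hx y hy
  unfold DGCA.plus at hx hy
  induction hx using Submodule.iSup_induction' with
  | zero => rw [zero_mul]; exact zero_mem _
  | add x x' _ _ h h' => rw [add_mul]; exact add_mem h h'
  | mem m x hx =>
    induction hy using Submodule.iSup_induction' with
    | zero => rw [mul_zero]; exact zero_mem _
    | add y y' _ _ h h' => rw [mul_add]; exact add_mem h h'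
    | mem n y hy =>
      have hxy : x * y ∈ A.grading (m + 1 + (n + 1)) := SetLike.GradedMul.mul_mem hx hy
      exact (le_iSup (fun n : ℕ => A.grading (n + 1)) (m + 1 + n)) hxy

theorem proj_zero_plus (A : DGCA.{u}) {a : A} (ha : a ∈ A.plus) :
    GradedAlgebra.proj A.grading 0 a = 0 := by
  have h : A.plus ≤ LinearMap.ker (GradedAlgebra.proj A.grading 0) :=
    iSup_le fun n x hx => by
      rw [LinearMap.mem_ker, GradedAlgebra.proj_apply]
      exact DirectSum.decompose_of_mem_ne A.grading hx (Nat.succ_ne_zero n)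
  exact h ha

theorem proj_plus_mul_plus (A : DGCA.{u}) (n : ℕ) {a : A}
    (ha : a ∈ A.plus * A.plus) : GradedAlgebra.proj A.grading n a ∈ A.plus * A.plus := by
  have h : A.plus * A.plus ≤ (A.plus * A.plus).comap (GradedAlgebra.proj A.grading n) := by
    rw [Submodule.mul_le]
    intro x hx y hy
    unfold DGCA.plus at hx hy
    induction hx using Submodule.iSup_induction' with
    | zero => rw [zero_mul]; exact zero_mem _
    | add x x' _ _ h h' => rw [add_mul]; exact add_mem h h'
    | mem i x hx =>
      induction hy using Submodule.iSup_induction' with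
      | zero => rw [mul_zero]; exact zero_mem _
      | add y y' _ _ h h' => rw [mul_add]; exact add_mem h h'
      | mem j y hy =>
        have hxy : x * y ∈ A.grading (i + 1 + (j + 1)) := SetLike.GradedMul.mul_mem hx hy
        rw [Submodule.mem_comap, GradedAlgebra.proj_apply]
        by_cases hn : i + 1 + (j + 1) = n
        · subst hn
          rw [DirectSum.decompose_of_mem_same A.grading hxy]
          exact Submodule.mul_mem_mul
            ((le_iSup (fun n : ℕ => A.grading (n + 1)) i) hx)
            ((le_iSup (fun n : ℕ => A.grading (n + 1)) j) hy)
        · rw [DirectSum.decompose_of_mem_ne A.grading hxy hn]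
          exact zero_mem _
  exact h ha

end DGCA

/-- The category `CDGA` of path-connected commutative differential graded algebras. -/
abbrev CDGA := (DGCA.IsPathConnected.{u}).FullSubcategory

namespace CDGA

/-- The cohomology functor on path-connected algebras. -/
abbrev H : CDGA.{u} ⥤ GVec.{u} := DGCA.IsPathConnected.ι ⋙ DGCA.cohomologyFunctor

/-- The quasi-isomorphisms: the morphisms that induce an isomorphism on cohomology. -/
def quasiIso : MorphismProperty CDGA.{u} :=
  (MorphismProperty.isomorphisms GVec.{u}).inverseImage H

end CDGA

/-- The homotopy category `Ho(CDGA)`: the localization of `CDGA` at the quasi-isomorphisms. -/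
abbrev HoCDGA := CDGA.quasiIso.{u}.Localization

/-- The canonical functor from `CDGA` to its homotopy category. -/
abbrev CDGA.toHo : CDGA.{u} ⥤ HoCDGA.{u} := CDGA.quasiIso.{u}.Q

/-! ### Sullivan algebras -/

section Free

variable (V : ℕ → Type u) [∀ n, AddCommGroup (V n)] [∀ n, Module ℚ (V n)]

/-- The relations `v ⊗ w = (-1)^(deg v * deg w) w ⊗ v` for homogeneous `v`, `w`. -/
inductive FreeGCRel :
    TensorAlgebra ℚ (DirectSum ℕ V) → TensorAlgebra ℚ (DirectSum ℕ V) → Prop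
  | swap (m n : ℕ) (v : V m) (w : V n) : FreeGCRel
      (TensorAlgebra.ι ℚ (DirectSum.lof ℚ ℕ V m v) * TensorAlgebra.ι ℚ (DirectSum.lof ℚ ℕ V n w))
      ((-1 : ℚ) ^ (m * n) • (TensorAlgebra.ι ℚ (DirectSum.lof ℚ ℕ V n w) *
        TensorAlgebra.ι ℚ (DirectSum.lof ℚ ℕ V m v)))

/-- The free graded commutative algebra `∧V` on a graded vector space `V`. -/
abbrev FreeGC : Type u := RingQuot (FreeGCRel V)

/-- The inclusion of the generators of degree `n` into `∧V`. -/
noncomputable def FreeGC.ι (n : ℕ) (v : V n) : FreeGC V :=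
  RingQuot.mkAlgHom ℚ (FreeGCRel V) (TensorAlgebra.ι ℚ (DirectSum.lof ℚ ℕ V n v))

end Free

/-- A minimal Sullivan algebra `(∧V, ∂)`: a commutative differential graded algebra `A` together
with a graded subspace `V` of `A`, concentrated in positive degrees, such that `A = ∧V`, the
differential is nilpotent with respect to an exhaustive filtration `V(0) ⊆ V(1) ⊆ ⋯` of `V` by
graded subspaces, and the image of the differential consists of decomposable elements. -/
structure MinimalSullivanAlgebra : Type (u + 1) where
  /-- the underlying algebra -/
  algebra : CDGA.{u}
  /-- the generators `Vⁿ` of degree `n` -/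
  V : ℕ → Submodule ℚ algebra.obj
  V_le : ∀ n, V n ≤ algebra.obj.grading n
  V_zero : V 0 = ⊥
  free : ∃ e : FreeGC (fun n => V n) ≃ₐ[ℚ] algebra.obj,
    ∀ (n : ℕ) (v : V n), e (FreeGC.ι (fun n => V n) n v) = v
  /-- `F k n` is the degree `n` part of `V(k)` -/
  nilpotent : ∃ F : ℕ → ℕ → Submodule ℚ algebra.obj,
    Monotone F ∧ (∀ n, ⨆ k, F k n = V n) ∧
    (∀ n, ∀ v ∈ F 0 n, algebra.obj.d v = 0) ∧
    (∀ k n, ∀ v ∈ F (k + 1) n,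
      algebra.obj.d v ∈ Algebra.adjoin ℚ (⋃ m, (F k m : Set algebra.obj)))
  minimal : ∀ a, algebra.obj.d a ∈ algebra.obj.plus * algebra.obj.plus

namespace MinimalSullivanAlgebra

instance : Category.{u} MinimalSullivanAlgebra.{u} :=
  inferInstanceAs (Category (InducedCategory CDGA.{u} MinimalSullivanAlgebra.algebra))

/-- The inclusion of the full subcategory of minimal Sullivan algebras, `(∧V, ∂) ↦ (∧V, ∂)`. -/
def toCDGA : MinimalSullivanAlgebra.{u} ⥤ CDGA.{u} :=
  inducedFunctor MinimalSullivanAlgebra.algebra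

variable (S : MinimalSullivanAlgebra.{u})

theorem V_le_plus (n : ℕ) : S.V n ≤ S.algebra.obj.plus := by
  cases n with
  | zero => rw [S.V_zero]; exact bot_le
  | succ n =>
    exact (S.V_le (n + 1)).trans (le_iSup (fun n : ℕ => S.algebra.obj.grading (n + 1)) n)

/-- The map from `Vⁿ` to the indecomposables of degree `n` of `∧V`, `v ↦ [v]`. -/
def toIndec (n : ℕ) : S.V n →ₗ[ℚ] S.algebra.obj.indec n :=
  (Submodule.mkQ _).comp (Submodule.inclusion (le_inf (S.V_le n) (S.V_le_plus n)))

/-- Coordinates on `∧V`: the constant term and the linear term of an element. -/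
theorem exists_linear_term : ∃ (ε : S.algebra.obj →ₗ[ℚ] ℚ)
    (l : S.algebra.obj →ₗ[ℚ] DirectSum ℕ (fun n => S.V n)),
    ε 1 = 1 ∧ l 1 = 0 ∧
    (∀ a b, ε (a * b) = ε a * ε b) ∧ (∀ a b, l (a * b) = ε a • l b + ε b • l a) ∧
    (∀ n (v : S.V n), ε v = 0 ∧ l v = DirectSum.lof ℚ ℕ (fun n => S.V n) n v) := by
  let _ : Module ℚᵐᵒᵖ (DirectSum ℕ (fun n => S.V n)) :=
    Module.compHom _ ((RingHom.id ℚ).fromOpposite (fun x y => mul_comm x y))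
  have _ : IsCentralScalar ℚ (DirectSum ℕ (fun n => S.V n)) := ⟨fun _ _ => rfl⟩
  obtain ⟨e, he⟩ := S.free
  let f : TensorAlgebra ℚ (DirectSum ℕ (fun n => S.V n)) →ₐ[ℚ]
      TrivSqZeroExt ℚ (DirectSum ℕ (fun n => S.V n)) :=
    TensorAlgebra.lift ℚ (TrivSqZeroExt.inrHom ℚ _)
  have hf : ∀ ⦃x y⦄, FreeGCRel (fun n => S.V n) x y → f x = f y := by
    rintro _ _ ⟨m, n, v, w⟩
    simp [f, TrivSqZeroExt.inr_mul_inr]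
  let g : FreeGC (fun n => S.V n) →ₐ[ℚ] TrivSqZeroExt ℚ (DirectSum ℕ (fun n => S.V n)) :=
    RingQuot.liftAlgHom ℚ ⟨f, hf⟩
  let p : S.algebra.obj →ₐ[ℚ] TrivSqZeroExt ℚ (DirectSum ℕ (fun n => S.V n)) :=
    g.comp e.symm.toAlgHom
  have hp : ∀ n (v : S.V n),
      p v = TrivSqZeroExt.inr (DirectSum.lof ℚ ℕ (fun n => S.V n) n v) := by
    intro n v
    have : e.symm (v : S.algebra.obj) = FreeGC.ι (fun n => S.V n) n v := by
      rw [AlgEquiv.symm_apply_eq, he]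
    change g (e.symm (v : S.algebra.obj)) = _
    rw [this]
    simp [g, FreeGC.ι, f]
  refine ⟨(TrivSqZeroExt.fstHom ℚ ℚ _).toLinearMap.comp p.toLinearMap,
    (TrivSqZeroExt.sndHom ℚ _).comp p.toLinearMap, ?_, ?_, ?_, ?_, ?_⟩
  · simp
  · simp
  · intro a b; simp
  · intro a b; simp
  · intro n v; simp [hp]

/-- Induction on `∧V` from the generators. -/
theorem induction_on {P : S.algebra.obj → Prop} (hV : ∀ n (v : S.V n), P v)
    (hc : ∀ q : ℚ, P (algebraMap ℚ S.algebra.obj q)) (hadd : ∀ a b, P a → P b → P (a + b))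
    (hmul : ∀ a b, P a → P b → P (a * b)) (a : S.algebra.obj) : P a := by
  obtain ⟨e, he⟩ := S.free
  obtain ⟨x, rfl⟩ := e.surjective a
  obtain ⟨y, rfl⟩ := RingQuot.mkAlgHom_surjective ℚ (FreeGCRel (fun n => S.V n)) x
  induction y using TensorAlgebra.induction with
  | algebraMap r => simpa using hc r
  | mul a b ha hb => simpa using hmul _ _ ha hb
  | add a b ha hb => simpa using hadd _ _ ha hb
  | ι m =>
    induction m using DirectSum.induction_on with
    | zero => simpa using hc 0
    | add a b ha hb => simpa using hadd _ _ ha hb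
    | of n v => 
      have := hV n v
      rw [← he] at this
      exact this

/-- The canonical map `Vⁿ → Qⁿ(∧V)` is bijective. -/
theorem toIndec_bijective (n : ℕ) : Function.Bijective (S.toIndec n) := by
  obtain ⟨ε, l, hε1, hl1, hε, hl, hv⟩ := S.exists_linear_term
  have hmem : ∀ m (v : S.V m), (v : S.algebra.obj) ∈ S.algebra.obj.plus := fun m v => S.V_le_plus m v.2
  have hc : ∀ q : ℚ, ε (algebraMap ℚ S.algebra.obj q) = q := fun q => by
    rw [Algebra.algebraMap_eq_smul_one, map_smul, hε1, smul_eq_mul, mul_one]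
  have hlc : ∀ q : ℚ, l (algebraMap ℚ S.algebra.obj q) = 0 := fun q => by
    rw [Algebra.algebraMap_eq_smul_one, map_smul, hl1, smul_zero]
  -- the augmentation vanishes in positive degrees
  have h1 : ∀ a : S.algebra.obj, a - algebraMap ℚ S.algebra.obj (ε a) ∈ S.algebra.obj.plus := by
    refine S.induction_on
      (P := fun a => a - algebraMap ℚ S.algebra.obj (ε a) ∈ S.algebra.obj.plus) ?_ ?_ ?_ ?_
    · intro m v
      rw [(hv m v).1, map_zero, sub_zero]
      exact hmem m v
    · intro q
      rw [hc, sub_self]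
      exact zero_mem _
    · intro a b ha hb
      rw [map_add, map_add, add_sub_add_comm]
      exact add_mem ha hb
    · intro a b ha hb
      have : a * b - algebraMap ℚ S.algebra.obj (ε (a * b)) =
          (a - algebraMap ℚ S.algebra.obj (ε a)) * (b - algebraMap ℚ S.algebra.obj (ε b)) +
          ε a • (b - algebraMap ℚ S.algebra.obj (ε b)) + ε b • (a - algebraMap ℚ S.algebra.obj (ε a)) := by
        simp only [hε, map_mul, Algebra.algebraMap_eq_smul_one, sub_mul, mul_sub, smul_sub,
          smul_mul_assoc, mul_smul_comm, one_mul, mul_one, smul_smul, mul_comm (ε b) (ε a)]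
        abel
      rw [this]
      exact add_mem (add_mem (S.algebra.obj.plus_mul_plus_le (Submodule.mul_mem_mul ha hb))
        (Submodule.smul_mem _ _ hb)) (Submodule.smul_mem _ _ ha)
  have h2 : ∀ a : S.algebra.obj, a ∈ S.algebra.obj.plus → ε a = 0 := by
    intro a ha
    have h3 : algebraMap ℚ S.algebra.obj (ε a) ∈ S.algebra.obj.plus := by
      have := sub_mem ha (h1 a)
      rwa [sub_sub_cancel] at this
    have h4 := S.algebra.obj.proj_zero_plus h3
    rw [GradedAlgebra.proj_apply, DirectSum.decompose_of_mem_same S.algebra.obj.grading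
      (SetLike.algebraMap_mem_graded S.algebra.obj.grading (ε a))] at h4
    rw [← hc (ε a), h4, map_zero]
  -- decomposable elements have no linear term
  have h3 : ∀ a : S.algebra.obj, a ∈ S.algebra.obj.plus * S.algebra.obj.plus → l a = 0 := by
    intro a ha
    have : S.algebra.obj.plus * S.algebra.obj.plus ≤ LinearMap.ker l := by
      rw [Submodule.mul_le]
      intro x hx y hy
      rw [LinearMap.mem_ker, hl, h2 x hx, h2 y hy, zero_smul, zero_smul, add_zero]
    exact this ha
  let L : DirectSum ℕ (fun n => S.V n) →ₗ[ℚ] S.algebra.obj :=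
    DirectSum.toModule ℚ ℕ S.algebra.obj (fun n => (S.V n).subtype)
  have hL : ∀ x, L x ∈ S.algebra.obj.plus := by
    intro x
    induction x using DirectSum.induction_on with
    | zero => rw [map_zero]; exact zero_mem _
    | add a b ha hb => rw [map_add]; exact add_mem ha hb
    | of m v =>
      have : L (DirectSum.of (fun n => S.V n) m v) = v :=
        DirectSum.toModule_lof (φ := fun n => (S.V n).subtype) ℚ m v
      rw [this]
      exact hmem m v
  have hLn : ∀ x, GradedAlgebra.proj S.algebra.obj.grading n (L x) = (x n : S.algebra.obj) := by
    intro x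
    induction x using DirectSum.induction_on with
    | zero => simp
    | add a b ha hb => rw [map_add, map_add, ha, hb]; rfl
    | of m v =>
      have : L (DirectSum.of (fun n => S.V n) m v) = v :=
        DirectSum.toModule_lof (φ := fun n => (S.V n).subtype) ℚ m v
      rw [this, GradedAlgebra.proj_apply]
      by_cases hmn : m = n
      · subst hmn
        rw [DirectSum.decompose_of_mem_same S.algebra.obj.grading (S.V_le m v.2), DirectSum.of_eq_same]
      · rw [DirectSum.decompose_of_mem_ne S.algebra.obj.grading (S.V_le m v.2) hmn,
          DirectSum.of_eq_of_ne _ _ _ (Ne.symm hmn)]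
        rfl
  have h4 : ∀ a : S.algebra.obj, a - algebraMap ℚ S.algebra.obj (ε a) - L (l a) ∈ S.algebra.obj.plus * S.algebra.obj.plus := by
    refine S.induction_on (P := fun a => a - algebraMap ℚ S.algebra.obj (ε a) - L (l a) ∈
      S.algebra.obj.plus * S.algebra.obj.plus) ?_ ?_ ?_ ?_
    · intro m v
      have : L (DirectSum.lof ℚ ℕ (fun n => S.V n) m v) = v :=
        DirectSum.toModule_lof (φ := fun n => (S.V n).subtype) ℚ m v
      rw [(hv m v).1, (hv m v).2, this, map_zero, sub_zero, sub_self]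
      exact zero_mem _
    · intro q
      rw [hc, hlc, map_zero, sub_self, sub_zero]
      exact zero_mem _
    · intro a b ha hb
      have : a + b - algebraMap ℚ S.algebra.obj (ε (a + b)) - L (l (a + b)) =
          (a - algebraMap ℚ S.algebra.obj (ε a) - L (l a)) + (b - algebraMap ℚ S.algebra.obj (ε b) - L (l b)) := by
        simp only [map_add]
        abel
      rw [this]
      exact add_mem ha hb
    · intro a b ha hb
      have : a * b - algebraMap ℚ S.algebra.obj (ε (a * b)) - L (l (a * b)) =
          (a - algebraMap ℚ S.algebra.obj (ε a)) * (b - algebraMap ℚ S.algebra.obj (ε b)) +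
          ε a • (b - algebraMap ℚ S.algebra.obj (ε b) - L (l b)) +
          ε b • (a - algebraMap ℚ S.algebra.obj (ε a) - L (l a)) := by
        simp only [hε, hl, map_add, map_smul, map_mul, Algebra.algebraMap_eq_smul_one, sub_mul,
          mul_sub, smul_sub, smul_mul_assoc, mul_smul_comm, one_mul, mul_one, smul_smul,
          mul_comm (ε b) (ε a)]
        abel
      rw [this]
      exact add_mem (add_mem (Submodule.mul_mem_mul (h1 a) (h1 b))
        (Submodule.smul_mem _ _ hb)) (Submodule.smul_mem _ _ ha)
  constructor
  · rw [injective_iff_map_eq_zero]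
    intro v hv0
    have hv1 : (v : S.algebra.obj) ∈ S.algebra.obj.plus * S.algebra.obj.plus := (Submodule.Quotient.mk_eq_zero (x := Submodule.inclusion
      (le_inf (S.V_le n) (S.V_le_plus n)) v) _).1 hv0
    have hv2 : DirectSum.of (fun n => S.V n) n v = 0 := ((hv n v).2.symm.trans (h3 _ hv1))
    exact DirectSum.of_injective n (hv2.trans (map_zero _).symm)
  · intro x
    obtain ⟨⟨a, ha⟩, rfl⟩ := Submodule.mkQ_surjective _ x
    refine ⟨l a n, ((Submodule.Quotient.eq _).2 ?_).symm⟩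
    change a - (l a n : S.algebra.obj) ∈ S.algebra.obj.plus * S.algebra.obj.plus
    have h5 := S.algebra.obj.proj_plus_mul_plus n (h4 a)
    rw [h2 a ha.2, map_zero, sub_zero, map_sub, hLn, GradedAlgebra.proj_apply,
      DirectSum.decompose_of_mem_same S.algebra.obj.grading ha.1] at h5
    exact h5

/-- The canonical isomorphism `Vⁿ ≅ Qⁿ(∧V)`. -/
noncomputable def indecEquiv (n : ℕ) : S.V n ≃ₗ[ℚ] S.algebra.obj.indec n :=
  LinearEquiv.ofBijective (S.toIndec n) (S.toIndec_bijective n)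

variable {S}

/-- The linear part `Vⁿ → Wⁿ` of a morphism `(∧V, ∂) ⟶ (∧W, ∂)`: the map that it induces on
indecomposables, read through the canonical isomorphisms `V ≅ Q(∧V)` and `W ≅ Q(∧W)`. -/
noncomputable def linearPart {T : MinimalSullivanAlgebra.{u}} (f : S ⟶ T) (n : ℕ) :
    S.V n →ₗ[ℚ] T.V n :=
  (T.indecEquiv n).symm.toLinearMap ∘ₗ
    DGCA.indecMap (A := S.algebra.obj) (B := T.algebra.obj) (f.hom.hom) n ∘ₗ
      (S.indecEquiv n).toLinearMap

theorem linearPart_id (n : ℕ) : linearPart (𝟙 S) n = LinearMap.id := by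
  apply LinearMap.ext
  intro v
  change (S.indecEquiv n).symm (DGCA.indecMap (𝟙 S.algebra.obj) n (S.indecEquiv n v)) = v
  rw [DGCA.indecMap_id, LinearMap.id_apply, LinearEquiv.symm_apply_apply]

theorem linearPart_comp {T U : MinimalSullivanAlgebra.{u}} (f : S ⟶ T) (g : T ⟶ U) (n : ℕ) :
    linearPart (f ≫ g) n = (linearPart g n).comp (linearPart f n) := by
  let f' : S.algebra.obj ⟶ T.algebra.obj := f.hom.hom
  let g' : T.algebra.obj ⟶ U.algebra.obj := g.hom.hom
  apply LinearMap.ext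
  intro v
  change (U.indecEquiv n).symm (DGCA.indecMap (f' ≫ g') n (S.indecEquiv n v)) =
    (U.indecEquiv n).symm (DGCA.indecMap g' n (T.indecEquiv n
      ((T.indecEquiv n).symm (DGCA.indecMap f' n (S.indecEquiv n v)))))
  rw [LinearEquiv.apply_symm_apply, DGCA.indecMap_comp, LinearMap.comp_apply]

/-- The functor `(∧V, ∂) ↦ V` from minimal Sullivan algebras to graded vector spaces, with the
linear part as its action on morphisms. -/
noncomputable def generators : MinimalSullivanAlgebra.{u} ⥤ GVec.{u} where
  obj S := fun n => ModuleCat.of ℚ (S.V n)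
  map f := fun n => ModuleCat.ofHom (linearPart f n)
  map_id _ := funext fun n => ModuleCat.hom_ext (linearPart_id n)
  map_comp f g := funext fun n => ModuleCat.hom_ext (linearPart_comp f g n)

end MinimalSullivanAlgebra

/-! A functor carries `δ`-interleavings to `δ`-interleavings, so it never increases the interleaving
distance. Cohomology inverts quasi-isomorphisms, hence factors through `HoCDGA`; this gives the
first inequality.

For the second, a morphism of `HoCDGA` between simply-connected minimal Sullivan algebras has to
induce a map of generators, compatibly with composition and equal to the linear part on honest
morphisms. The link is homotopy: `f, g : A ⟶ X` are homotopic if they are the ends of a morphism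
into the path object `X ⊗ ∧(t, dt)`.

(a) For a minimal Sullivan algebra `S`, the functor `X ↦ [S, X]` of homotopy classes inverts
quasi-isomorphisms (`isIso_homotopyClasses`). For a surjective quasi-isomorphism, whose kernel is
acyclic, morphisms and homotopies lift generator by generator along the filtration of `V`, because
each obstruction is a cocycle in an acyclic kernel (`exists_hom_graph_le`,
`AcyclicKernel.path_lift`). A general quasi-isomorphism is a section of one surjective
quasi-isomorphism followed by another (mapping path object). So `[S, -]` descends to `HoCDGA`, and
the image of the class of the identity, as in the Yoneda lemma, turns a morphism of `HoCDGA` out of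
`S` into a homotopy class (`rep`), compatibly with composition (`rep_comp`).

(b) Homotopic morphisms from a simply-connected `S` to a minimal `T` have the same linear part
(`Homotopic.sub_mem`). Here `S¹ = 0`, so a homotopy `H` sends `S⁺` to paths whose two coefficients
both lie in `T⁺`, and `S⁺ · S⁺` to paths with decomposable `dt`-coefficient. As `da` is decomposable
for each `a`, and `T` is minimal, the `t`-derivative of the path `H a` is decomposable; integrating
from `0` to `1` shows that its ends agree modulo decomposables.

Together these define `hoLinearPart`, which sends every interleaving in `HoCDGA` to one of
generators. The auxiliary path objects and fibre products live in `DGCA`, where path-connectedness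
plays no role. -/

open scoped TensorProduct Polynomial

/-! ### Homogeneous projections and the degree involution of a DGCA -/

/-- A family of submodules with a compatible family of projections is a decomposition. -/
theorem DirectSum.isInternal_of_projections {A : Type*} [AddCommGroup A] [Module ℚ A]
    (𝒜 : ℕ → Submodule ℚ A) (π : ℕ → A →ₗ[ℚ] A)
    (hsame : ∀ n, ∀ a ∈ 𝒜 n, π n a = a) (hne : ∀ m n, m ≠ n → ∀ a ∈ 𝒜 n, π m a = 0)
    (htop : ⨆ n, 𝒜 n = ⊤) : DirectSum.IsInternal 𝒜 := by
  refine DirectSum.isInternal_submodule_of_iSupIndep_of_iSup_eq_top ?_ htop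
  rw [iSupIndep_def]
  intro i
  rw [Submodule.disjoint_def]
  intro x hx hx'
  have h : (⨆ (j) (_ : j ≠ i), 𝒜 j) ≤ LinearMap.ker (π i) :=
    iSup₂_le fun j hj y hy => hne i j hj.symm y hy
  rw [← hsame i x hx]
  exact h hx'

namespace DGCA

section Basic

variable (A : DGCA.{u})

/-- The projection to the part of degree `n`. -/
noncomputable abbrev proj (n : ℕ) : A →ₗ[ℚ] A := GradedAlgebra.proj A.grading n

theorem proj_mem (n : ℕ) (a : A) : A.proj n a ∈ A.grading n := SetLike.coe_mem _

theorem proj_of_mem {n : ℕ} {a : A} (ha : a ∈ A.grading n) : A.proj n a = a :=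
  DirectSum.decompose_of_mem_same A.grading ha

theorem proj_of_mem_ne {m n : ℕ} {a : A} (ha : a ∈ A.grading m) (h : m ≠ n) : A.proj n a = 0 :=
  DirectSum.decompose_of_mem_ne A.grading ha h

theorem homogeneous_induction {P : A → Prop} (h0 : P 0) (hadd : ∀ a b, P a → P b → P (a + b))
    (h : ∀ n, ∀ a ∈ A.grading n, P a) (a : A) : P a :=
  DirectSum.Decomposition.inductionOn A.grading h0 (fun {i} m => h i m m.2)
    (fun m n => hadd m n) a

theorem linearMap_ext {M : Type*} [AddCommGroup M] [Module ℚ M] {f g : A →ₗ[ℚ] M}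
    (h : ∀ n, ∀ a ∈ A.grading n, f a = g a) : f = g := by
  ext a
  induction a using A.homogeneous_induction with
  | h0 => simp
  | hadd a b ha hb => simp [ha, hb]
  | h n a ha => exact h n a ha

theorem d_proj (n : ℕ) (a : A) : A.proj (n + 1) (A.d a) = A.d (A.proj n a) := by
  have : A.proj (n + 1) ∘ₗ A.d = A.d ∘ₗ A.proj n := A.linearMap_ext fun m a ha => by
    by_cases h : m = n
    · subst h
      simp only [LinearMap.comp_apply, A.proj_of_mem ha, A.proj_of_mem (A.d_mem m a ha)]
    · simp only [LinearMap.comp_apply, A.proj_of_mem_ne ha h,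
        A.proj_of_mem_ne (A.d_mem m a ha) (by omega : m + 1 ≠ n + 1), map_zero]
  exact LinearMap.congr_fun this a

theorem proj_zero_d (a : A) : A.proj 0 (A.d a) = 0 := by
  have : A.proj 0 ∘ₗ A.d = 0 := A.linearMap_ext fun m a ha =>
    A.proj_of_mem_ne (A.d_mem m a ha) (Nat.succ_ne_zero m)
  exact LinearMap.congr_fun this a

/-- The degree involution `a ↦ (-1)^(deg a) a`. -/
noncomputable def sgn : A →ₗ[ℚ] A :=
  DirectSum.toModule ℚ ℕ A (fun n => (-1 : ℚ) ^ n • (A.grading n).subtype) ∘ₗ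
    (DirectSum.decomposeLinearEquiv A.grading).toLinearMap

theorem sgn_of_mem {n : ℕ} {a : A} (ha : a ∈ A.grading n) : A.sgn a = (-1 : ℚ) ^ n • a := by
  lift a to A.grading n using ha
  simp only [sgn, LinearMap.comp_apply, LinearEquiv.coe_coe, DirectSum.decomposeLinearEquiv_apply,
    DirectSum.decompose_coe]
  exact DirectSum.toModule_lof (φ := fun n => (-1 : ℚ) ^ n • (A.grading n).subtype) ℚ n a

theorem neg_one_pow_mul {R : Type*} [Ring R] [Algebra ℚ R] (n : ℕ) (a : R) :
    (-1) ^ n * a = (-1 : ℚ) ^ n • a := by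
  rcases Nat.even_or_odd n with h | h <;> simp [h.neg_one_pow]

theorem neg_one_pow_mul_self (n : ℕ) : (-1 : ℚ) ^ n * (-1) ^ n = 1 := by
  rw [← mul_pow]; simp

theorem sgn_one : A.sgn 1 = 1 := by
  rw [A.sgn_of_mem (SetLike.GradedOne.one_mem), pow_zero, one_smul]

theorem sgn_sgn (a : A) : A.sgn (A.sgn a) = a := by
  have : A.sgn ∘ₗ A.sgn = LinearMap.id := A.linearMap_ext fun n a ha => by
    simp only [LinearMap.comp_apply, A.sgn_of_mem ha, map_smul, smul_smul, neg_one_pow_mul_self,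
      one_smul, LinearMap.id_apply]
  exact LinearMap.congr_fun this a

theorem sgn_d (a : A) : A.sgn (A.d a) = - A.d (A.sgn a) := by
  have : A.sgn ∘ₗ A.d = - A.d ∘ₗ A.sgn := A.linearMap_ext fun n a ha => by
    simp only [LinearMap.comp_apply, LinearMap.neg_apply, A.sgn_of_mem ha,
      A.sgn_of_mem (A.d_mem n a ha), map_smul, pow_succ]
    module
  exact LinearMap.congr_fun this a

theorem sgn_mul (a b : A) : A.sgn (a * b) = A.sgn a * A.sgn b := by
  induction a using A.homogeneous_induction with
  | h0 => simp
  | hadd a a' h h' => simp only [add_mul, map_add, h, h']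
  | h m a ha =>
    induction b using A.homogeneous_induction with
    | h0 => simp
    | hadd b b' h h' => simp only [mul_add, map_add, h, h']
    | h n b hb =>
      rw [A.sgn_of_mem ha, A.sgn_of_mem hb, A.sgn_of_mem (SetLike.GradedMul.mul_mem ha hb),
        smul_mul_smul_comm, pow_add]

/-- With the sign written as the involution `sgn`, both sides are bilinear, so the Leibniz rule
extends to inhomogeneous elements and can be applied to polynomial coefficients. -/
theorem d_mul (a b : A) : A.d (a * b) = A.d a * b + A.sgn a * A.d b := by
  induction a using A.homogeneous_induction with
  | h0 => simp
  | hadd a a' h h' => simp only [add_mul, map_add, h, h']; abel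
  | h m a ha => rw [A.leibniz m a b ha, A.sgn_of_mem ha, neg_one_pow_mul, smul_mul_assoc]

theorem d_one : A.d 1 = 0 := by
  have := A.d_mul 1 1
  rw [sgn_one, mul_one, mul_one, one_mul] at this
  simpa using this

theorem d_algebraMap (q : ℚ) : A.d (algebraMap ℚ A q) = 0 := by
  rw [Algebra.algebraMap_eq_smul_one, map_smul, d_one, smul_zero]

theorem sum_proj (a : A) : ∃ s : Finset ℕ, a = ∑ n ∈ s, A.proj n a := by
  classical
  exact ⟨_, (DirectSum.sum_support_decompose A.grading a).symm⟩

theorem graded_comm' {m n : ℕ} {a b : A} (ha : a ∈ A.grading m) (hb : b ∈ A.grading n) :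
    a * b = (-1 : ℚ) ^ (m * n) • (b * a) := by
  rw [A.graded_comm m n a b ha hb, neg_one_pow_mul]

end Basic

theorem hom_ext {A B : DGCA.{u}} {f g : A ⟶ B} (h : ∀ a, f.toAlgHom a = g.toAlgHom a) : f = g :=
  Hom.ext (AlgHom.ext h)

section Maps

variable {A B C : DGCA.{u}} (f : A ⟶ B)

@[simp] theorem id_apply (a : A) : Hom.toAlgHom (𝟙 A) a = a := rfl

@[simp] theorem comp_apply (g : B ⟶ C) (a : A) :
    (f ≫ g).toAlgHom a = g.toAlgHom (f.toAlgHom a) := rfl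

theorem map_proj (n : ℕ) (a : A) : f.toAlgHom (A.proj n a) = B.proj n (f.toAlgHom a) := by
  have : f.toAlgHom.toLinearMap ∘ₗ A.proj n = B.proj n ∘ₗ f.toAlgHom.toLinearMap :=
    A.linearMap_ext fun m a ha => by
      by_cases h : m = n
      · subst h
        simp [A.proj_of_mem ha, B.proj_of_mem (f.map_mem m a ha)]
      · simp [A.proj_of_mem_ne ha h, B.proj_of_mem_ne (f.map_mem m a ha) h]
  exact LinearMap.congr_fun this a

theorem map_sgn (a : A) : f.toAlgHom (A.sgn a) = B.sgn (f.toAlgHom a) := by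
  have : f.toAlgHom.toLinearMap ∘ₗ A.sgn = B.sgn ∘ₗ f.toAlgHom.toLinearMap :=
    A.linearMap_ext fun m a ha => by
      simp [A.sgn_of_mem ha, B.sgn_of_mem (f.map_mem m a ha)]
  exact LinearMap.congr_fun this a

/-! ### Quasi-isomorphisms and acyclic kernels -/

/-- `f` induces an isomorphism on total cohomology. -/
structure IsQuasiIso : Prop where
  inj : ∀ x, A.d x = 0 → f.toAlgHom x ∈ LinearMap.range B.d → x ∈ LinearMap.range A.d
  surj : ∀ y, B.d y = 0 → ∃ x, A.d x = 0 ∧ y - f.toAlgHom x ∈ LinearMap.range B.d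

/-- Homogeneous projections commute with `f` and shift along `d`, so cocycles and coboundaries split
into finitely many homogeneous ones and the degreewise statements add up. -/
theorem isQuasiIso_of_bijective (h : ∀ n, Function.Bijective (cohomologyMap f n)) :
    IsQuasiIso f where
  inj x hx := by
    rintro ⟨y, hy⟩
    have key : ∀ n, A.proj n x ∈ LinearMap.range A.d := by
      intro n
      have hc : A.proj n x ∈ A.cocycles n :=
        ⟨by change A.d (A.proj n x) = 0; rw [← d_proj, hx, map_zero], A.proj_mem n x⟩
      have h0 : cohomologyMap f n (Submodule.Quotient.mk ⟨A.proj n x, hc⟩) = 0 := by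
        refine (Submodule.Quotient.mk_eq_zero _).2 ?_
        change f.toAlgHom (A.proj n x) ∈ LinearMap.range B.d
        rw [map_proj, ← hy]
        cases n with
        | zero => rw [proj_zero_d]; exact zero_mem _
        | succ n => rw [d_proj]; exact ⟨_, rfl⟩
      have h1 := (h n).1 (h0.trans (map_zero _).symm)
      exact (Submodule.Quotient.mk_eq_zero (A.coboundaries n)).1 h1
    obtain ⟨s, hs⟩ := A.sum_proj x
    rw [hs]
    exact sum_mem fun n _ => key n
  surj y hy := by
    have key : ∀ n, ∃ x, A.d x = 0 ∧ B.proj n y - f.toAlgHom x ∈ LinearMap.range B.d := by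
      intro n
      have hc : B.proj n y ∈ B.cocycles n :=
        ⟨by change B.d (B.proj n y) = 0; rw [← d_proj, hy, map_zero], B.proj_mem n y⟩
      obtain ⟨q, hq⟩ := (h n).2 (Submodule.Quotient.mk ⟨B.proj n y, hc⟩)
      obtain ⟨x, rfl⟩ := Submodule.Quotient.mk_surjective _ q
      exact ⟨x, x.2.1, (Submodule.Quotient.eq (B.coboundaries n)).1 hq.symm⟩
    choose x hx hxy using key
    obtain ⟨s, hs⟩ := B.sum_proj y
    refine ⟨∑ n ∈ s, x n, by simp [hx], ?_⟩
    rw [hs, map_sum, ← Finset.sum_sub_distrib]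
    exact sum_mem fun n _ => hxy n

/-- The kernel of `f` is acyclic. -/
def AcyclicKernel : Prop :=
  ∀ k, f.toAlgHom k = 0 → A.d k = 0 → ∃ k', f.toAlgHom k' = 0 ∧ A.d k' = k

variable {f}

/-- A piece of the long exact sequence of `0 → ker f → A → B → 0`. A primitive `x` of `k` has a
cocycle of `B` as image; subtracting from `x` a cocycle of `A` and a coboundary with the same total
image moves the primitive into the kernel. -/
theorem IsQuasiIso.acyclicKernel (h : IsQuasiIso f) (hs : Function.Surjective f.toAlgHom) :
    AcyclicKernel f := by
  intro k hk hdk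
  obtain ⟨x, rfl⟩ := h.inj k hdk (by rw [hk]; exact zero_mem _)
  obtain ⟨z, hz, y, hy⟩ := h.surj (f.toAlgHom x) (by rw [← f.map_d, hk])
  obtain ⟨y, rfl⟩ := hs y
  refine ⟨x - z - A.d y, ?_, ?_⟩
  · rw [map_sub, map_sub, f.map_d, hy, sub_self]
  · rw [map_sub, map_sub, hz, A.d_d, sub_zero, sub_zero]

theorem AcyclicKernel.isQuasiIso (h : AcyclicKernel f) (hs : Function.Surjective f.toAlgHom) :
    IsQuasiIso f where
  inj x hx := by
    rintro ⟨y, hy⟩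
    obtain ⟨y, rfl⟩ := hs y
    obtain ⟨k, -, hk⟩ := h (x - A.d y) (by rw [map_sub, f.map_d, hy, sub_self])
      (by rw [map_sub, hx, A.d_d, sub_zero])
    exact ⟨k + y, by rw [map_add, hk, sub_add_cancel]⟩
  surj y hy := by
    obtain ⟨x, rfl⟩ := hs y
    obtain ⟨k, hk, hdk⟩ := h (A.d x) (by rw [f.map_d, hy]) (A.d_d x)
    refine ⟨x - k, by rw [map_sub, hdk, sub_self], ?_⟩
    rw [map_sub, hk, sub_zero, sub_self]
    exact zero_mem _

theorem IsQuasiIso.of_comp_left {g : B ⟶ C} (hf : IsQuasiIso f) (hfg : IsQuasiIso (f ≫ g)) :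
    IsQuasiIso g where
  inj y hy := by
    intro hgy
    obtain ⟨x, hx, z, hz⟩ := hf.surj y hy
    obtain ⟨w, rfl⟩ := hfg.inj x hx (by
      obtain ⟨c, hc⟩ := hgy
      refine ⟨c - g.toAlgHom z, ?_⟩
      rw [map_sub, hc, ← g.map_d, hz, map_sub, comp_apply, sub_sub_cancel])
    rw [f.map_d] at hz
    exact ⟨z + f.toAlgHom w, by rw [map_add, hz, sub_add_cancel]⟩
  surj z hz := by
    obtain ⟨x, hx, hxz⟩ := hfg.surj z hz
    exact ⟨f.toAlgHom x, by rw [← f.map_d, hx, map_zero], hxz⟩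

theorem IsQuasiIso.of_comp_right {g : B ⟶ C} (hg : IsQuasiIso g) (hfg : IsQuasiIso (f ≫ g)) :
    IsQuasiIso f where
  inj x hx := by
    rintro ⟨y, hy⟩
    exact hfg.inj x hx ⟨g.toAlgHom y, by rw [← g.map_d, hy]; rfl⟩
  surj y hy := by
    obtain ⟨x, hx, z, hz⟩ := hfg.surj (g.toAlgHom y) (by rw [← g.map_d, hy, map_zero])
    refine ⟨x, hx, hg.inj _ ?_ ⟨z, ?_⟩⟩
    · rw [map_sub, hy, ← f.map_d, hx, map_zero, sub_zero]
    · rw [hz, map_sub]; rfl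

theorem isQuasiIso_id : IsQuasiIso (𝟙 A) where
  inj _ _ h := h
  surj y hy := ⟨y, hy, by rw [id_apply, sub_self]; exact zero_mem _⟩

/-- A contraction of an acyclic kernel, extended to the whole algebra. -/
theorem AcyclicKernel.exists_contraction (h : AcyclicKernel f) :
    ∃ s : A →ₗ[ℚ] A, (∀ a, f.toAlgHom (s a) = 0) ∧
      ∀ k, f.toAlgHom k = 0 → A.d (s k) + s (A.d k) = k := by
  let K : Submodule ℚ A := LinearMap.ker f.toAlgHom.toLinearMap
  let Z : Submodule ℚ A := K ⊓ LinearMap.ker A.d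
  let D : K →ₗ[ℚ] Z := (A.d.comp K.subtype).codRestrict Z fun k =>
    ⟨by
      have hk : f.toAlgHom k = 0 := k.2
      change f.toAlgHom (A.d k) = 0
      rw [f.map_d, hk, map_zero], A.d_d k⟩
  -- Acyclicity says that `d` maps the kernel `K` onto its cocycles `Z`; over a field this
  -- surjection has a linear section. Linearity is needed in order to apply the contraction to
  -- coefficients of polynomials.
  obtain ⟨r, hr⟩ := D.exists_rightInverse_of_surjective (by
    rw [LinearMap.range_eq_top]
    rintro ⟨z, hz, hdz⟩
    obtain ⟨k, hk, hkz⟩ := h z hz hdz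
    exact ⟨⟨k, hk⟩, Subtype.ext hkz⟩)
  obtain ⟨p, hp⟩ := Z.subtype.exists_leftInverse_of_injective Z.ker_subtype
  let R : A →ₗ[ℚ] A := K.subtype ∘ₗ r ∘ₗ p
  have hR0 : ∀ a, f.toAlgHom (R a) = 0 := fun a => (r (p a)).2
  have hR : ∀ z, f.toAlgHom z = 0 → A.d z = 0 → A.d (R z) = z := by
    intro z hz hdz
    have h1 : p z = ⟨z, hz, hdz⟩ := LinearMap.congr_fun hp ⟨z, hz, hdz⟩
    have h2 := congrArg Subtype.val (LinearMap.congr_fun hr ⟨z, hz, hdz⟩)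
    change A.d (r (p z) : A) = z
    rw [h1]
    exact h2
  -- `R` inverts `d` on the cocycles of the kernel. For `k` in the kernel, `k - R (d k)` is such a
  -- cocycle, so `d (s k) = k - R (d k)`, while `s (d k) = R (d k)`.
  refine ⟨R ∘ₗ (LinearMap.id - R ∘ₗ A.d), fun a => hR0 _, fun k hk => ?_⟩
  have hdk : A.d (R (A.d k)) = A.d k := hR _ (by rw [f.map_d, hk, map_zero]) (A.d_d k)
  simp only [LinearMap.comp_apply, LinearMap.sub_apply, LinearMap.id_apply, A.d_d, map_zero,
    sub_zero]
  rw [hR _ (by rw [map_sub, hk, hR0, sub_zero]) (by rw [map_sub, hdk, sub_self]), sub_add_cancel]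

end Maps

end DGCA

/-! ### Formal integration of rational polynomials -/

namespace Polynomial

/-- The primitive of a rational polynomial that vanishes at `0`. -/
noncomputable def primitive : ℚ[X] →ₗ[ℚ] ℚ[X] :=
  (Polynomial.basisMonomials ℚ).constr ℚ fun n => monomial (n + 1) ((n + 1 : ℚ)⁻¹)

theorem primitive_monomial_one (n : ℕ) :
    primitive (monomial n 1) = monomial (n + 1) ((n + 1 : ℚ)⁻¹) := by
  have := (Polynomial.basisMonomials ℚ).constr_basis ℚ
    (fun n => (monomial (n + 1) ((n + 1 : ℚ)⁻¹) : ℚ[X])) n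
  rwa [Polynomial.coe_basisMonomials] at this

theorem derivative_primitive (p : ℚ[X]) : derivative (primitive p) = p := by
  have : (derivative : ℚ[X] →ₗ[ℚ] ℚ[X]) ∘ₗ primitive = LinearMap.id := by
    refine (Polynomial.basisMonomials ℚ).ext fun n => ?_
    rw [Polynomial.coe_basisMonomials]
    have h : (n + 1 : ℚ) ≠ 0 := by positivity
    simp [primitive_monomial_one, h]
  exact LinearMap.congr_fun this p

theorem primitive_derivative (p : ℚ[X]) : primitive (derivative p) = p - C (p.eval 0) := by
  have : primitive ∘ₗ (derivative : ℚ[X] →ₗ[ℚ] ℚ[X]) =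
      LinearMap.id - (monomial 0 : ℚ →ₗ[ℚ] ℚ[X]) ∘ₗ leval 0 := by
    refine (Polynomial.basisMonomials ℚ).ext fun n => ?_
    rw [Polynomial.coe_basisMonomials]
    cases n with
    | zero => simp
    | succ n =>
      have h : (n + 1 : ℚ) ≠ 0 := by positivity
      have h2 : (derivative (monomial (n + 1) 1) : ℚ[X]) = (n + 1 : ℚ) • monomial n 1 := by
        rw [derivative_monomial, smul_monomial]
        simp
      rw [LinearMap.comp_apply, h2, map_smul, primitive_monomial_one, smul_monomial,
        smul_eq_mul, mul_inv_cancel₀ h]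
      simp
  exact LinearMap.congr_fun this p

theorem eval_zero_primitive (p : ℚ[X]) : (primitive p).eval 0 = 0 := by
  have : (leval 0 : ℚ[X] →ₗ[ℚ] ℚ) ∘ₗ primitive = 0 := by
    refine (Polynomial.basisMonomials ℚ).ext fun n => ?_
    rw [Polynomial.coe_basisMonomials]
    simp [primitive_monomial_one]
  exact LinearMap.congr_fun this p

end Polynomial

/-! ### Polynomials with coefficients in a DGCA -/

namespace DGCA

variable (A B : DGCA.{u})

/-- The algebra `A[t]` of polynomials in a central variable of degree `0`. -/
abbrev Poly : Type u := A ⊗[ℚ] ℚ[X]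

namespace Poly

variable {A B}

/-- A linear map applied to the coefficients. -/
noncomputable abbrev coeff {M N : Type u} [AddCommGroup M] [Module ℚ M] [AddCommGroup N]
    [Module ℚ N] (f : M →ₗ[ℚ] N) : M ⊗[ℚ] ℚ[X] →ₗ[ℚ] N ⊗[ℚ] ℚ[X] := f.rTensor ℚ[X]

/-- Differentiation with respect to `t`. -/
noncomputable abbrev deriv (M : Type u) [AddCommGroup M] [Module ℚ M] :
    M ⊗[ℚ] ℚ[X] →ₗ[ℚ] M ⊗[ℚ] ℚ[X] :=
  (Polynomial.derivative : ℚ[X] →ₗ[ℚ] ℚ[X]).lTensor M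

/-- Integration from `0` to `t`. -/
noncomputable abbrev integral (M : Type u) [AddCommGroup M] [Module ℚ M] :
    M ⊗[ℚ] ℚ[X] →ₗ[ℚ] M ⊗[ℚ] ℚ[X] :=
  Polynomial.primitive.lTensor M

/-- Evaluation at `t = c`. -/
noncomputable def eval (M : Type u) [AddCommGroup M] [Module ℚ M] (c : ℚ) :
    M ⊗[ℚ] ℚ[X] →ₗ[ℚ] M :=
  (TensorProduct.rid ℚ M).toLinearMap ∘ₗ (Polynomial.leval c).lTensor M

@[simp] theorem eval_tmul {M : Type u} [AddCommGroup M] [Module ℚ M] (c : ℚ) (a : M) (p : ℚ[X]) :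
    eval M c (a ⊗ₜ p) = p.eval c • a := by
  simp [eval]

theorem coeff_deriv {M N : Type u} [AddCommGroup M] [Module ℚ M] [AddCommGroup N]
    [Module ℚ N] (f : M →ₗ[ℚ] N) (z : M ⊗[ℚ] ℚ[X]) :
    coeff f (deriv M z) = deriv N (coeff f z) := by
  induction z using TensorProduct.induction_on with
  | zero => simp
  | tmul a p => simp
  | add x y hx hy => simp only [map_add, hx, hy]

theorem coeff_integral {M N : Type u} [AddCommGroup M] [Module ℚ M] [AddCommGroup N]
    [Module ℚ N] (f : M →ₗ[ℚ] N) (z : M ⊗[ℚ] ℚ[X]) :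
    coeff f (integral M z) = integral N (coeff f z) := by
  induction z using TensorProduct.induction_on with
  | zero => simp
  | tmul a p => simp
  | add x y hx hy => simp only [map_add, hx, hy]

theorem eval_coeff {M N : Type u} [AddCommGroup M] [Module ℚ M] [AddCommGroup N]
    [Module ℚ N] (f : M →ₗ[ℚ] N) (c : ℚ) (z : M ⊗[ℚ] ℚ[X]) :
    eval N c (coeff f z) = f (eval M c z) := by
  induction z using TensorProduct.induction_on with
  | zero => simp
  | tmul a p => simp
  | add x y hx hy => simp only [map_add, hx, hy]

section Module

variable {M : Type u} [AddCommGroup M] [Module ℚ M]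

theorem deriv_integral (z : M ⊗[ℚ] ℚ[X]) : deriv M (integral M z) = z := by
  induction z using TensorProduct.induction_on with
  | zero => simp
  | tmul a p => simp [Polynomial.derivative_primitive]
  | add x y hx hy => simp only [map_add, hx, hy]

theorem integral_deriv (z : M ⊗[ℚ] ℚ[X]) :
    integral M (deriv M z) = z - eval M 0 z ⊗ₜ 1 := by
  induction z using TensorProduct.induction_on with
  | zero => simp
  | tmul a p =>
    simp only [LinearMap.lTensor_tmul, Polynomial.primitive_derivative, TensorProduct.tmul_sub,
      eval_tmul, TensorProduct.smul_tmul]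
    rw [Polynomial.smul_eq_C_mul, mul_one]
  | add x y hx hy => simp only [map_add, hx, hy, TensorProduct.add_tmul]; abel

theorem eval_zero_integral (z : M ⊗[ℚ] ℚ[X]) : eval M 0 (integral M z) = 0 := by
  induction z using TensorProduct.induction_on with
  | zero => simp
  | tmul a p => simp [Polynomial.eval_zero_primitive]
  | add x y hx hy => simp only [map_add, hx, hy, add_zero]

/-- The difference of the values at `1` and at `0` is the integral of the derivative. -/
theorem eval_one_sub_eval_zero (z : M ⊗[ℚ] ℚ[X]) :
    eval M 1 z - eval M 0 z = eval M 1 (integral M (deriv M z)) := by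
  rw [integral_deriv, map_sub, eval_tmul, Polynomial.eval_one, one_smul]

theorem coeff_comp {N P : Type u} [AddCommGroup N] [Module ℚ N] [AddCommGroup P] [Module ℚ P]
    (g : N →ₗ[ℚ] P) (f : M →ₗ[ℚ] N) (z : M ⊗[ℚ] ℚ[X]) :
    coeff g (coeff f z) = coeff (g ∘ₗ f) z := by
  rw [coeff, coeff, coeff, LinearMap.rTensor_comp, LinearMap.comp_apply]

end Module

theorem coeff_sgn_sgn (z : A.Poly) : coeff A.sgn (coeff A.sgn z) = z := by
  rw [coeff_comp, (LinearMap.ext A.sgn_sgn : A.sgn ∘ₗ A.sgn = LinearMap.id), coeff,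
    LinearMap.rTensor_id, LinearMap.id_apply]

theorem coeff_d_d (z : A.Poly) : coeff A.d (coeff A.d z) = 0 := by
  rw [coeff_comp, (LinearMap.ext A.d_d : A.d ∘ₗ A.d = 0), coeff,
    LinearMap.rTensor_zero, LinearMap.zero_apply]

theorem coeff_sgn_d (z : A.Poly) : coeff A.sgn (coeff A.d z) = - coeff A.d (coeff A.sgn z) := by
  rw [coeff_comp, coeff_comp, (LinearMap.ext A.sgn_d : A.sgn ∘ₗ A.d = -(A.d ∘ₗ A.sgn)), coeff,
    LinearMap.rTensor_neg, LinearMap.neg_apply]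

theorem coeff_sgn_mul (y z : A.Poly) :
    coeff A.sgn (y * z) = coeff A.sgn y * coeff A.sgn z := by
  induction y using TensorProduct.induction_on with
  | zero => simp
  | add x y hx hy => simp only [map_add, add_mul, hx, hy]
  | tmul a p =>
    induction z using TensorProduct.induction_on with
    | zero => simp
    | add x y hx hy => simp only [map_add, mul_add, hx, hy]
    | tmul b q => simp [A.sgn_mul]

theorem coeff_sgn_one : coeff A.sgn (1 : A.Poly) = 1 := by
  rw [Algebra.TensorProduct.one_def, coeff, LinearMap.rTensor_tmul, sgn_one]

theorem coeff_d_mul (y z : A.Poly) :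
    coeff A.d (y * z) = coeff A.d y * z + coeff A.sgn y * coeff A.d z := by
  induction y using TensorProduct.induction_on with
  | zero => simp
  | add x y hx hy => simp only [map_add, add_mul, hx, hy]; abel
  | tmul a p =>
    induction z using TensorProduct.induction_on with
    | zero => simp
    | add x y hx hy => simp only [map_add, mul_add, hx, hy]; abel
    | tmul b q => simp [A.d_mul, TensorProduct.add_tmul]

theorem deriv_mul (y z : A.Poly) :
    deriv A (y * z) = deriv A y * z + y * deriv A z := by
  induction y using TensorProduct.induction_on with
  | zero => simp
  | add x y hx hy => simp only [map_add, add_mul, hx, hy]; abel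
  | tmul a p =>
    induction z using TensorProduct.induction_on with
    | zero => simp
    | add x y hx hy => simp only [map_add, mul_add, hx, hy]; abel
    | tmul b q => simp [Polynomial.derivative_mul, TensorProduct.tmul_add]

theorem eval_mul (c : ℚ) (y z : A.Poly) : eval A c (y * z) = eval A c y * eval A c z := by
  induction y using TensorProduct.induction_on with
  | zero => simp
  | add x y hx hy => simp only [map_add, add_mul, hx, hy]
  | tmul a p =>
    induction z using TensorProduct.induction_on with
    | zero => simp
    | add x y hx hy => simp only [map_add, mul_add, hx, hy]
    | tmul b q => simp [smul_smul, mul_comm]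

theorem eval_one (c : ℚ) : eval A c (1 : A.Poly) = 1 := by
  rw [Algebra.TensorProduct.one_def, eval_tmul, Polynomial.eval_one, one_smul]

theorem coeff_hom_mul (f : A ⟶ B) (y z : A.Poly) :
    coeff f.toAlgHom.toLinearMap (y * z) =
      coeff f.toAlgHom.toLinearMap y * coeff f.toAlgHom.toLinearMap z := by
  induction y using TensorProduct.induction_on with
  | zero => simp
  | add x y hx hy => simp only [map_add, add_mul, hx, hy]
  | tmul a p =>
    induction z using TensorProduct.induction_on with
    | zero => simp
    | add x y hx hy => simp only [map_add, mul_add, hx, hy]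
    | tmul b q => simp

theorem coeff_hom_one (f : A ⟶ B) : coeff f.toAlgHom.toLinearMap (1 : A.Poly) = 1 := by
  rw [Algebra.TensorProduct.one_def, coeff, LinearMap.rTensor_tmul]
  simp [Algebra.TensorProduct.one_def]

theorem coeff_hom_d (f : A ⟶ B) (z : A.Poly) :
    coeff f.toAlgHom.toLinearMap (coeff A.d z) = coeff B.d (coeff f.toAlgHom.toLinearMap z) := by
  rw [coeff_comp, coeff_comp]
  congr 2
  exact LinearMap.ext f.map_d

theorem coeff_hom_sgn (f : A ⟶ B) (z : A.Poly) :
    coeff f.toAlgHom.toLinearMap (coeff A.sgn z) =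
      coeff B.sgn (coeff f.toAlgHom.toLinearMap z) := by
  rw [coeff_comp, coeff_comp]
  congr 2
  exact LinearMap.ext (map_sgn f)

/-- The subspace of the polynomials with coefficients in a given subspace. -/
noncomputable def span {M : Type u} [AddCommGroup M] [Module ℚ M] (U : Submodule ℚ M) :
    Submodule ℚ (M ⊗[ℚ] ℚ[X]) := LinearMap.range (coeff U.subtype)

theorem tmul_mem_span {M : Type u} [AddCommGroup M] [Module ℚ M] {U : Submodule ℚ M} {a : M}
    (ha : a ∈ U) (p : ℚ[X]) : a ⊗ₜ p ∈ span U :=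
  ⟨(⟨a, ha⟩ : U) ⊗ₜ p, by simp⟩

theorem span_le_iff {M : Type u} [AddCommGroup M] [Module ℚ M] {U : Submodule ℚ M}
    {P : Submodule ℚ (M ⊗[ℚ] ℚ[X])} : span U ≤ P ↔ ∀ a ∈ U, ∀ p : ℚ[X], a ⊗ₜ p ∈ P := by
  refine ⟨fun h a ha p => h (tmul_mem_span ha p), ?_⟩
  rintro h _ ⟨z, rfl⟩
  induction z using TensorProduct.induction_on with
  | zero => simp
  | tmul a p => simpa using h a a.2 p
  | add x y hx hy => rw [map_add]; exact add_mem hx hy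

theorem coeff_mem_span {M N : Type u} [AddCommGroup M] [Module ℚ M] [AddCommGroup N]
    [Module ℚ N] {f : M →ₗ[ℚ] N} {U : Submodule ℚ M} {V : Submodule ℚ N}
    (h : ∀ a ∈ U, f a ∈ V) {z : M ⊗[ℚ] ℚ[X]} (hz : z ∈ span U) : coeff f z ∈ span V := by
  refine (span_le_iff (P := (span V).comap (coeff f))).2 (fun a ha p => ?_) hz
  simpa using tmul_mem_span (h a ha) p

theorem deriv_mem_span {M : Type u} [AddCommGroup M] [Module ℚ M] {U : Submodule ℚ M}
    {z : M ⊗[ℚ] ℚ[X]} (hz : z ∈ span U) : deriv M z ∈ span U := by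
  refine (span_le_iff (P := (span U).comap (deriv M))).2 (fun a ha p => ?_) hz
  simpa using tmul_mem_span ha _

theorem integral_mem_span {M : Type u} [AddCommGroup M] [Module ℚ M] {U : Submodule ℚ M}
    {z : M ⊗[ℚ] ℚ[X]} (hz : z ∈ span U) : integral M z ∈ span U := by
  refine (span_le_iff (P := (span U).comap (integral M))).2 (fun a ha p => ?_) hz
  simpa using tmul_mem_span ha _

theorem eval_mem {M : Type u} [AddCommGroup M] [Module ℚ M] {U : Submodule ℚ M}
    {z : M ⊗[ℚ] ℚ[X]} (c : ℚ) (hz : z ∈ span U) : eval M c z ∈ U := by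
  refine (span_le_iff (P := U.comap (eval M c))).2 (fun a ha p => ?_) hz
  simpa using U.smul_mem _ ha

theorem mul_mem_span {U V W : Submodule ℚ A} (h : ∀ a ∈ U, ∀ b ∈ V, a * b ∈ W)
    {y z : A.Poly} (hy : y ∈ span U) (hz : z ∈ span V) : y * z ∈ span W := by
  refine (span_le_iff (P := (span W).comap (LinearMap.mulRight ℚ z))).2 (fun a ha p => ?_) hy
  refine (span_le_iff (P := (span W).comap (LinearMap.mulLeft ℚ (a ⊗ₜ p)))).2
    (fun b hb q => ?_) hz
  simpa using tmul_mem_span (h a ha b hb) _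

theorem span_mono {M : Type u} [AddCommGroup M] [Module ℚ M] {U V : Submodule ℚ M} (h : U ≤ V) :
    span U ≤ span V :=
  span_le_iff.2 fun _ ha p => tmul_mem_span (h ha) p

theorem mem_span_top {M : Type u} [AddCommGroup M] [Module ℚ M] (z : M ⊗[ℚ] ℚ[X]) :
    z ∈ span (⊤ : Submodule ℚ M) := by
  induction z using TensorProduct.induction_on with
  | zero => exact zero_mem _
  | tmul a p => exact tmul_mem_span Submodule.mem_top p
  | add x y hx hy => exact add_mem hx hy

theorem coeff_eqOn {M N : Type u} [AddCommGroup M] [Module ℚ M] [AddCommGroup N]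
    [Module ℚ N] {f g : M →ₗ[ℚ] N} {U : Submodule ℚ M} (h : ∀ a ∈ U, f a = g a)
    {z : M ⊗[ℚ] ℚ[X]} (hz : z ∈ span U) : coeff f z = coeff g z := by
  refine (span_le_iff (P := LinearMap.eqLocus (coeff f) (coeff g))).2 (fun a ha p => ?_) hz
  simp [h a ha]

theorem iSup_span : ⨆ n, span (A.grading n) = ⊤ := by
  rw [eq_top_iff]
  rintro z -
  induction z using TensorProduct.induction_on with
  | zero => exact zero_mem _
  | add x y hx hy => exact add_mem hx hy
  | tmul a p =>
    induction a using A.homogeneous_induction with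
    | h0 => rw [TensorProduct.zero_tmul]; exact zero_mem _
    | hadd a b ha hb => rw [TensorProduct.add_tmul]; exact add_mem ha hb
    | h n a ha => exact le_iSup (fun n => span (A.grading n)) n (tmul_mem_span ha p)

theorem comm_of_mem {m n : ℕ} {y z : A.Poly} (hy : y ∈ span (A.grading m))
    (hz : z ∈ span (A.grading n)) : y * z = (-1 : ℚ) ^ (m * n) • (z * y) := by
  refine (span_le_iff (P := LinearMap.eqLocus (LinearMap.mulRight ℚ z)
    ((-1 : ℚ) ^ (m * n) • LinearMap.mulLeft ℚ z))).2 (fun a ha p => ?_) hy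
  refine (span_le_iff (P := LinearMap.eqLocus (LinearMap.mulLeft ℚ (a ⊗ₜ p))
    ((-1 : ℚ) ^ (m * n) • LinearMap.mulRight ℚ (a ⊗ₜ p)))).2 (fun b hb q => ?_) hz
  simp only [LinearMap.mem_eqLocus, LinearMap.mulLeft_apply, LinearMap.smul_apply,
    LinearMap.mulRight_apply, Algebra.TensorProduct.tmul_mul_tmul]
  rw [A.graded_comm' ha hb, mul_comm p q, TensorProduct.smul_tmul']

/-- A polynomial that a surjective linear map sends to zero has coefficients in the kernel. -/
theorem mem_span_ker {M N : Type u} [AddCommGroup M] [Module ℚ M] [AddCommGroup N]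
    [Module ℚ N] {f : M →ₗ[ℚ] N} (hf : Function.Surjective f) {z : M ⊗[ℚ] ℚ[X]}
    (hz : coeff f z = 0) : z ∈ span (LinearMap.ker f) :=
  (rTensor_exact ℚ[X] f.exact_subtype_ker_map hf z).1 hz

end Poly

end DGCA

/-! ### The path object `A ⊗ ∧(t, dt)` -/

namespace DGCA

variable (A B : DGCA.{u})

/-- The underlying space of `A ⊗ ∧(t, dt)`: a pair `(f, g)` stands for `f + g dt`. -/
@[ext]
structure PathSpace : Type u where
  /-- the coefficient of `1` -/
  fst : A.Poly
  /-- the coefficient of `dt` -/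
  snd : A.Poly

namespace PathSpace

variable {A B}

/-- The two coordinates of a path. -/
def equivProd : A.PathSpace ≃ A.Poly × A.Poly where
  toFun x := (x.1, x.2)
  invFun x := ⟨x.1, x.2⟩

noncomputable instance instAddCommGroup : AddCommGroup A.PathSpace := equivProd.addCommGroup
noncomputable instance instModule : Module ℚ A.PathSpace := equivProd.module ℚ

/-- Moving `dt`, of degree one, to the right past `y.1` produces the involution `sgn`; the product
of the two `dt`-terms disappears because `dt² = 0`. -/
noncomputable instance instMul : Mul A.PathSpace :=
  ⟨fun x y => ⟨x.1 * y.1, x.1 * y.2 + x.2 * Poly.coeff A.sgn y.1⟩⟩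
noncomputable instance instOne : One A.PathSpace := ⟨⟨1, 0⟩⟩

@[simp] theorem add_fst (x y : A.PathSpace) : (x + y).1 = x.1 + y.1 := rfl
@[simp] theorem add_snd (x y : A.PathSpace) : (x + y).2 = x.2 + y.2 := rfl
@[simp] theorem zero_fst : (0 : A.PathSpace).1 = 0 := rfl
@[simp] theorem zero_snd : (0 : A.PathSpace).2 = 0 := rfl
@[simp] theorem smul_fst (q : ℚ) (x : A.PathSpace) : (q • x).1 = q • x.1 := rfl
@[simp] theorem smul_snd (q : ℚ) (x : A.PathSpace) : (q • x).2 = q • x.2 := rfl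
@[simp] theorem one_fst : (1 : A.PathSpace).1 = 1 := rfl
@[simp] theorem one_snd : (1 : A.PathSpace).2 = 0 := rfl
@[simp] theorem mul_fst (x y : A.PathSpace) : (x * y).1 = x.1 * y.1 := rfl
@[simp] theorem mul_snd (x y : A.PathSpace) :
    (x * y).2 = x.1 * y.2 + x.2 * Poly.coeff A.sgn y.1 := rfl

noncomputable instance : Ring A.PathSpace :=
  { instAddCommGroup, instMul, instOne with
    left_distrib := fun x y z => by
      ext
      · simp only [mul_fst, add_fst, mul_add]
      · simp only [mul_snd, add_fst, add_snd, mul_add, map_add]; abel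
    right_distrib := fun x y z => by
      ext
      · simp only [mul_fst, add_fst, add_mul]
      · simp only [mul_snd, add_fst, add_snd, add_mul]; abel
    zero_mul := fun x => by ext <;> simp
    mul_zero := fun x => by ext <;> simp
    mul_assoc := fun x y z => by
      ext
      · simp only [mul_fst, mul_assoc]
      · simp only [mul_fst, mul_snd, Poly.coeff_sgn_mul, add_mul, mul_add, mul_assoc, add_assoc]
    one_mul := fun x => by ext <;> simp
    mul_one := fun x => by ext <;> simp [Poly.coeff_sgn_one] }

noncomputable instance : Algebra ℚ A.PathSpace :=
  Algebra.ofModule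
    (fun q x y => PathSpace.ext (smul_mul_assoc q x.1 y.1) (by
      simp only [mul_snd, smul_fst, smul_snd, smul_add]
      rw [smul_mul_assoc, smul_mul_assoc]))
    (fun q x y => PathSpace.ext (mul_smul_comm q x.1 y.1) (by
      simp only [mul_snd, smul_fst, smul_snd, smul_add, map_smul]
      rw [mul_smul_comm, mul_smul_comm]))

/-- The first coordinate as a linear map. -/
noncomputable def fstₗ : A.PathSpace →ₗ[ℚ] A.Poly where
  toFun x := x.1
  map_add' _ _ := rfl
  map_smul' _ _ := rfl

/-- The second coordinate as a linear map. -/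
noncomputable def sndₗ : A.PathSpace →ₗ[ℚ] A.Poly where
  toFun x := x.2
  map_add' _ _ := rfl
  map_smul' _ _ := rfl

/-- Linear maps applied to the two coordinates. -/
noncomputable def mapₗ (f g : A.Poly →ₗ[ℚ] B.Poly) : A.PathSpace →ₗ[ℚ] B.PathSpace where
  toFun x := ⟨f x.1, g x.2⟩
  map_add' x y := by ext <;> simp
  map_smul' q x := by ext <;> simp

/-- The inclusion of the first coordinate. -/
noncomputable def inlₗ : A.Poly →ₗ[ℚ] A.PathSpace where
  toFun z := ⟨z, 0⟩
  map_add' x y := by ext <;> simp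
  map_smul' q x := by ext <;> simp

/-- The inclusion of the second coordinate. -/
noncomputable def inrₗ : A.Poly →ₗ[ℚ] A.PathSpace where
  toFun z := ⟨0, z⟩
  map_add' x y := by ext <;> simp
  map_smul' q x := by ext <;> simp

/-- The homogeneous parts of `A ⊗ ∧(t, dt)`. -/
noncomputable def grading : ℕ → Submodule ℚ A.PathSpace
  -- The coefficient of `dt` has degree one less than the element, so in degree `0` it has to
  -- vanish.
  | 0 => (Poly.span (A.grading 0)).comap fstₗ ⊓ (⊥ : Submodule ℚ A.Poly).comap sndₗ
  | n + 1 => (Poly.span (A.grading (n + 1))).comap fstₗ ⊓ (Poly.span (A.grading n)).comap sndₗ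

theorem mem_grading_succ {n : ℕ} {x : A.PathSpace} (h₁ : x.1 ∈ Poly.span (A.grading (n + 1)))
    (h₂ : x.2 ∈ Poly.span (A.grading n)) : x ∈ grading (n + 1) := ⟨h₁, h₂⟩

theorem fst_mem {n : ℕ} {x : A.PathSpace} (hx : x ∈ grading n) :
    x.1 ∈ Poly.span (A.grading n) := by
  cases n <;> exact hx.1

theorem snd_eq_zero {x : A.PathSpace} (hx : x ∈ grading 0) : x.2 = 0 := hx.2

theorem snd_mem {n : ℕ} {x : A.PathSpace} (hx : x ∈ grading (n + 1)) :
    x.2 ∈ Poly.span (A.grading n) := hx.2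

/-- The projections to the homogeneous parts. -/
noncomputable def projection : ℕ → A.PathSpace →ₗ[ℚ] A.PathSpace
  | 0 => mapₗ (Poly.coeff (A.proj 0)) 0
  | n + 1 => mapₗ (Poly.coeff (A.proj (n + 1))) (Poly.coeff (A.proj n))

theorem coeff_proj_of_mem {n : ℕ} {z : A.Poly} (hz : z ∈ Poly.span (A.grading n)) :
    Poly.coeff (A.proj n) z = z := by
  have := Poly.coeff_eqOn (f := A.proj n) (g := LinearMap.id) (fun a ha => A.proj_of_mem ha) hz
  rwa [Poly.coeff, Poly.coeff, LinearMap.rTensor_id] at this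

theorem coeff_proj_of_mem_ne {m n : ℕ} {z : A.Poly} (hz : z ∈ Poly.span (A.grading m))
    (h : m ≠ n) : Poly.coeff (A.proj n) z = 0 := by
  have := Poly.coeff_eqOn (f := A.proj n) (g := 0) (fun a ha => A.proj_of_mem_ne ha h) hz
  rwa [Poly.coeff, Poly.coeff, LinearMap.rTensor_zero] at this

theorem isInternal_grading : DirectSum.IsInternal (grading (A := A)) := by
  refine DirectSum.isInternal_of_projections _ projection ?_ ?_ ?_
  · rintro (_ | n) x hx
    · exact PathSpace.ext (coeff_proj_of_mem (fst_mem hx)) (snd_eq_zero hx).symm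
    · exact PathSpace.ext (coeff_proj_of_mem (fst_mem hx)) (coeff_proj_of_mem (snd_mem hx))
  · rintro (_ | m) (_ | n) hmn x hx
    · exact absurd rfl hmn
    · exact PathSpace.ext (coeff_proj_of_mem_ne (fst_mem hx) hmn.symm) rfl
    · refine PathSpace.ext (coeff_proj_of_mem_ne (fst_mem hx) hmn.symm) ?_
      change Poly.coeff (A.proj m) x.2 = 0
      rw [snd_eq_zero hx, map_zero]
    · exact PathSpace.ext (coeff_proj_of_mem_ne (fst_mem hx) hmn.symm)
        (coeff_proj_of_mem_ne (snd_mem hx) (by omega))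
  · have h1 : (⊤ : Submodule ℚ A.Poly) ≤
        (⨆ n, grading (A := A) n).comap (PathSpace.inlₗ) := by
      rw [← Poly.iSup_span, iSup_le_iff]
      intro n z hz
      refine (le_iSup (grading (A := A)) n) ?_
      cases n
      · exact ⟨hz, rfl⟩
      · exact mem_grading_succ hz (zero_mem _)
    have h2 : (⊤ : Submodule ℚ A.Poly) ≤
        (⨆ n, grading (A := A) n).comap (PathSpace.inrₗ) := by
      rw [← Poly.iSup_span, iSup_le_iff]
      intro n z hz
      exact (le_iSup (grading (A := A)) (n + 1)) (mem_grading_succ (zero_mem _) hz)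
    rw [eq_top_iff]
    rintro x -
    have hx : x = PathSpace.inlₗ x.1 + PathSpace.inrₗ x.2 :=
      PathSpace.ext (add_zero _).symm (zero_add _).symm
    rw [hx]
    exact add_mem (h1 (Submodule.mem_top (x := x.1))) (h2 (Submodule.mem_top (x := x.2)))

theorem sgn_of_mem {n : ℕ} {z : A.Poly} (hz : z ∈ Poly.span (A.grading n)) :
    Poly.coeff A.sgn z = (-1 : ℚ) ^ n • z := by
  have := Poly.coeff_eqOn (f := A.sgn) (g := (-1 : ℚ) ^ n • LinearMap.id)
    (fun a ha => A.sgn_of_mem ha) hz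
  rwa [Poly.coeff, Poly.coeff, LinearMap.rTensor_smul, LinearMap.rTensor_id] at this

theorem sgn_mem {n : ℕ} {z : A.Poly} (hz : z ∈ Poly.span (A.grading n)) :
    Poly.coeff A.sgn z ∈ Poly.span (A.grading n) := by
  rw [sgn_of_mem hz]
  exact Submodule.smul_mem _ _ hz

theorem poly_mul_mem {m n k : ℕ} (h : m + n = k) {y z : A.Poly}
    (hy : y ∈ Poly.span (A.grading m)) (hz : z ∈ Poly.span (A.grading n)) :
    y * z ∈ Poly.span (A.grading k) := by
  subst h
  exact Poly.mul_mem_span (fun a ha b hb => SetLike.GradedMul.mul_mem ha hb) hy hz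

instance : SetLike.GradedMonoid (grading (A := A)) where
  one_mem := ⟨Poly.tmul_mem_span SetLike.GradedOne.one_mem 1, rfl⟩
  mul_mem := by
    intro m n x y hx hy
    have h1 : (x * y).1 ∈ Poly.span (A.grading (m + n)) :=
      poly_mul_mem rfl (fst_mem hx) (fst_mem hy)
    rcases m with _ | m <;> rcases n with _ | n
    · refine ⟨h1, ?_⟩
      change (x * y).2 = 0
      rw [mul_snd, snd_eq_zero hx, snd_eq_zero hy, mul_zero, zero_mul, add_zero]
    · rw [zero_add] at h1 ⊢
      refine mem_grading_succ h1 ?_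
      rw [mul_snd, snd_eq_zero hx, zero_mul, add_zero]
      exact poly_mul_mem (zero_add n) (fst_mem hx) (snd_mem hy)
    · refine mem_grading_succ h1 ?_
      rw [mul_snd, snd_eq_zero hy, mul_zero, zero_add]
      exact poly_mul_mem (add_zero m) (snd_mem hx) (sgn_mem (fst_mem hy))
    · refine mem_grading_succ h1 ?_
      rw [mul_snd]
      exact add_mem (poly_mul_mem rfl (fst_mem hx) (snd_mem hy))
        (poly_mul_mem (show m + (n + 1) = m + 1 + n by omega) (snd_mem hx) (sgn_mem (fst_mem hy)))

noncomputable instance : GradedAlgebra (grading (A := A)) := isInternal_grading.gradedAlgebra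

/-- The differential of `A ⊗ ∧(t, dt)`. -/
noncomputable def d : A.PathSpace →ₗ[ℚ] A.PathSpace where
  -- From `d (a p(t)) = (d a) p + (-1)^(deg a) a p' dt` and `d (b dt) = (d b) dt`.
  toFun x := ⟨Poly.coeff A.d x.1, Poly.coeff A.d x.2 + Poly.coeff A.sgn (Poly.deriv A x.1)⟩
  map_add' x y := by
    ext
    · simp
    · simp only [add_fst, add_snd, map_add]; abel
  map_smul' q x := by
    ext
    · simp
    · simp [smul_add]

@[simp] theorem d_fst (x : A.PathSpace) : (d x).1 = Poly.coeff A.d x.1 := rfl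
@[simp] theorem d_snd (x : A.PathSpace) :
    (d x).2 = Poly.coeff A.d x.2 + Poly.coeff A.sgn (Poly.deriv A x.1) := rfl

/-- The `dt`-coefficient has degree `n - 1`, so its own sign differs by one factor `-1` from that of
the path. -/
theorem neg_one_pow_smul_snd {n : ℕ} {x : A.PathSpace} (hx : x ∈ grading n) :
    (-1 : ℚ) ^ n • x.2 = - Poly.coeff A.sgn x.2 := by
  cases n with
  | zero => rw [snd_eq_zero hx, map_zero, smul_zero, neg_zero]
  | succ n =>
    rw [sgn_of_mem (snd_mem hx), pow_succ]
    module

end PathSpace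

/-- The path object `A ⊗ ∧(t, dt)`. -/
noncomputable def path : DGCA.{u} where
  carrier := A.PathSpace
  grading := PathSpace.grading
  d := PathSpace.d
  d_mem := by
    intro n x hx
    have h1 : (PathSpace.d x).1 ∈ Poly.span (A.grading (n + 1)) :=
      Poly.coeff_mem_span (A.d_mem n) (PathSpace.fst_mem hx)
    refine PathSpace.mem_grading_succ h1 ?_
    rw [PathSpace.d_snd]
    refine add_mem ?_ (PathSpace.sgn_mem (Poly.deriv_mem_span (PathSpace.fst_mem hx)))
    cases n with
    | zero => rw [PathSpace.snd_eq_zero hx, map_zero]; exact zero_mem _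
    | succ n => exact Poly.coeff_mem_span (A.d_mem n) (PathSpace.snd_mem hx)
  d_d x := by
    refine PathSpace.ext ?_ ?_
    · exact Poly.coeff_d_d _
    · simp only [PathSpace.d_snd, PathSpace.d_fst, map_add, Poly.coeff_d_d, zero_add,
        ← Poly.coeff_deriv, Poly.coeff_sgn_d, add_neg_cancel, PathSpace.zero_snd]
  leibniz n x y hx := by
    rw [neg_one_pow_mul]
    refine PathSpace.ext ?_ ?_
    · simp only [PathSpace.d_fst, PathSpace.mul_fst, PathSpace.add_fst, PathSpace.smul_fst,
        Poly.coeff_d_mul, PathSpace.sgn_of_mem (PathSpace.fst_mem hx), smul_mul_assoc]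
    · have hneg : ∀ a b : A.Poly, -a * -b = a * b := fun a b => neg_mul_neg a b
      simp only [PathSpace.d_fst, PathSpace.d_snd, PathSpace.mul_fst, PathSpace.mul_snd,
        PathSpace.add_snd, PathSpace.smul_snd]
      rw [smul_add, ← smul_mul_assoc, ← smul_mul_assoc, PathSpace.neg_one_pow_smul_snd hx,
        ← PathSpace.sgn_of_mem (PathSpace.fst_mem hx), map_add, Poly.coeff_d_mul,
        Poly.coeff_d_mul, Poly.deriv_mul, map_add, Poly.coeff_sgn_mul, Poly.coeff_sgn_mul,
        Poly.coeff_sgn_d, hneg]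
      noncomm_ring
  graded_comm m n x y hx hy := by
    rw [neg_one_pow_mul]
    refine PathSpace.ext (Poly.comm_of_mem (PathSpace.fst_mem hx) (PathSpace.fst_mem hy)) ?_
    -- Since `y.2` has degree `n - 1`, commuting it with `x.1` gives only `(-1)^(m * (n - 1))`; the
    -- missing `(-1)^m` is the involution on `x.1`.
    have key : ∀ {m n : ℕ} {x y : A.PathSpace}, x ∈ PathSpace.grading m →
        y ∈ PathSpace.grading n →
        x.1 * y.2 = (-1 : ℚ) ^ (m * n) • (y.2 * Poly.coeff A.sgn x.1) := by
      intro m n x y hx hy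
      cases n with
      | zero => rw [PathSpace.snd_eq_zero hy]; simp
      | succ n =>
        rw [Poly.comm_of_mem (PathSpace.fst_mem hx) (PathSpace.snd_mem hy),
          PathSpace.sgn_of_mem (PathSpace.fst_mem hx), mul_smul_comm, smul_smul, mul_add, mul_one,
          pow_add, mul_assoc, neg_one_pow_mul_self, mul_one]
    rw [PathSpace.smul_snd, PathSpace.mul_snd, PathSpace.mul_snd, key hx hy, key hy hx, smul_add,
      smul_smul, mul_comm n m, neg_one_pow_mul_self, one_smul, add_comm]

variable {A B}

/-- Evaluation at `t = c`. -/
noncomputable def pathEval (A : DGCA.{u}) (c : ℚ) : A.path ⟶ A where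
  toAlgHom := AlgHom.ofLinearMap (Poly.eval A c ∘ₗ PathSpace.fstₗ)
    (Poly.eval_one c) (fun x y => Poly.eval_mul c x.1 y.1)
  map_mem _ _ hx := Poly.eval_mem c (PathSpace.fst_mem hx)
  map_d x := Poly.eval_coeff A.d c x.1

theorem pathEval_apply (c : ℚ) (x : A.path) : (A.pathEval c).toAlgHom x = Poly.eval A c x.1 := rfl

/-- The constant paths. -/
noncomputable def pathConst (A : DGCA.{u}) : A ⟶ A.path where
  toAlgHom := AlgHom.ofLinearMap
    (PathSpace.inlₗ ∘ₗ (TensorProduct.mk ℚ A ℚ[X]).flip 1)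
    rfl (fun x y => PathSpace.ext
      (by change (x * y) ⊗ₜ 1 = (x ⊗ₜ 1) * (y ⊗ₜ 1); simp)
      (by change (0 : A.Poly) = (x ⊗ₜ 1) * 0 + 0 * _; simp))
  map_mem n x hx := by
    cases n with
    | zero => exact ⟨Poly.tmul_mem_span hx 1, rfl⟩
    | succ n => exact PathSpace.mem_grading_succ (Poly.tmul_mem_span hx 1) (zero_mem _)
  map_d x := PathSpace.ext
    (by change (A.d x) ⊗ₜ 1 = Poly.coeff A.d (x ⊗ₜ 1); simp)
    (by
      change (0 : A.Poly) = Poly.coeff A.d 0 + Poly.coeff A.sgn (Poly.deriv A (x ⊗ₜ 1))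
      simp)

theorem pathConst_eval (c : ℚ) : A.pathConst ≫ A.pathEval c = 𝟙 A := by
  refine hom_ext fun a => ?_
  change Poly.eval A c (a ⊗ₜ 1) = a
  simp

/-- The map induced on path objects. -/
noncomputable def pathMap (f : A ⟶ B) : A.path ⟶ B.path where
  toAlgHom := AlgHom.ofLinearMap (PathSpace.mapₗ (Poly.coeff f.toAlgHom.toLinearMap)
      (Poly.coeff f.toAlgHom.toLinearMap))
    (PathSpace.ext (Poly.coeff_hom_one f) (map_zero _))
    (fun x y => PathSpace.ext (Poly.coeff_hom_mul f _ _) (by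
      change Poly.coeff f.toAlgHom.toLinearMap (x.1 * y.2 + x.2 * Poly.coeff A.sgn y.1) =
        Poly.coeff f.toAlgHom.toLinearMap x.1 * Poly.coeff f.toAlgHom.toLinearMap y.2 +
          Poly.coeff f.toAlgHom.toLinearMap x.2 *
            Poly.coeff B.sgn (Poly.coeff f.toAlgHom.toLinearMap y.1)
      rw [map_add, Poly.coeff_hom_mul, Poly.coeff_hom_mul, Poly.coeff_hom_sgn]))
  map_mem n x hx := by
    have h1 := Poly.coeff_mem_span (f := f.toAlgHom.toLinearMap) (f.map_mem n)
      (PathSpace.fst_mem hx)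
    cases n with
    | zero =>
      refine ⟨h1, ?_⟩
      change Poly.coeff f.toAlgHom.toLinearMap x.2 = 0
      rw [PathSpace.snd_eq_zero hx, map_zero]
    | succ n =>
      exact ⟨h1, Poly.coeff_mem_span (f := f.toAlgHom.toLinearMap) (f.map_mem n)
        (PathSpace.snd_mem hx)⟩
  map_d x := PathSpace.ext (Poly.coeff_hom_d f _) (by
    change Poly.coeff f.toAlgHom.toLinearMap (Poly.coeff A.d x.2 +
        Poly.coeff A.sgn (Poly.deriv A x.1)) =
      Poly.coeff B.d (Poly.coeff f.toAlgHom.toLinearMap x.2) +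
        Poly.coeff B.sgn (Poly.deriv B (Poly.coeff f.toAlgHom.toLinearMap x.1))
    rw [map_add, Poly.coeff_hom_d, Poly.coeff_hom_sgn, Poly.coeff_deriv])

theorem pathMap_eval (f : A ⟶ B) (c : ℚ) :
    pathMap f ≫ B.pathEval c = A.pathEval c ≫ f :=
  hom_ext fun x => Poly.eval_coeff f.toAlgHom.toLinearMap c x.1

/-- The kernel of the evaluation at `0` is acyclic. -/
theorem acyclicKernel_pathEval_zero : AcyclicKernel (A.pathEval 0) := by
  intro x hx hdx
  have h1 : Poly.coeff A.d x.1 = 0 := congrArg PathSpace.fst hdx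
  have h2 : Poly.coeff A.d x.2 + Poly.coeff A.sgn (Poly.deriv A x.1) = 0 :=
    congrArg PathSpace.snd hdx
  -- A primitive without `dt`-part, `h`, must satisfy `sgn h' = x.2`, so `h` is the integral of `sgn
  -- x.2` from `0`. The cocycle condition identifies `d h` with `x.1 - x.1(0)`, and `x.1(0) = 0`.
  refine ⟨⟨Poly.integral A (Poly.coeff A.sgn x.2), 0⟩, ?_, ?_⟩
  · exact Poly.eval_zero_integral _
  · refine PathSpace.ext ?_ ?_
    · change Poly.coeff A.d (Poly.integral A (Poly.coeff A.sgn x.2)) = x.1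
      rw [Poly.coeff_integral, ← neg_neg (Poly.coeff A.d (Poly.coeff A.sgn x.2)),
        ← Poly.coeff_sgn_d, eq_neg_of_add_eq_zero_left h2, map_neg, map_neg, map_neg, neg_neg,
        Poly.coeff_sgn_sgn, Poly.integral_deriv]
      rw [pathEval_apply] at hx
      rw [hx, TensorProduct.zero_tmul, sub_zero]
    · change Poly.coeff A.d 0 + Poly.coeff A.sgn
        (Poly.deriv A (Poly.integral A (Poly.coeff A.sgn x.2))) = x.2
      rw [Poly.deriv_integral, Poly.coeff_sgn_sgn, map_zero, zero_add]

/-- A cocycle in the path object of `A` is the differential of a path with prescribed image and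
end points, if `f` is an acyclic surjection and the prescribed data are compatible. -/
theorem AcyclicKernel.path_lift {f : A ⟶ B} (h : AcyclicKernel f)
    (hs : Function.Surjective f.toAlgHom) {y : A.path} (hy : A.path.d y = 0) {z : B.path}
    (hz : (pathMap f).toAlgHom y = B.path.d z) {a₀ a₁ : A}
    (h₀ : (A.pathEval 0).toAlgHom y = A.d a₀) (h₁ : (A.pathEval 1).toAlgHom y = A.d a₁)
    (hz₀ : (B.pathEval 0).toAlgHom z = f.toAlgHom a₀)
    (hz₁ : (B.pathEval 1).toAlgHom z = f.toAlgHom a₁) :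
    ∃ x : A.path, A.path.d x = y ∧ (pathMap f).toAlgHom x = z ∧
      (A.pathEval 0).toAlgHom x = a₀ ∧ (A.pathEval 1).toAlgHom x = a₁ := by
  -- a lift of `z` with the correct endpoints
  obtain ⟨ξ, hξ, hξ₀, hξ₁⟩ : ∃ ξ : A.path, (pathMap f).toAlgHom ξ = z ∧
      (A.pathEval 0).toAlgHom ξ = a₀ ∧ (A.pathEval 1).toAlgHom ξ = a₁ := by
    have hsurj : Function.Surjective (Poly.coeff f.toAlgHom.toLinearMap) :=
      LinearMap.rTensor_surjective _ hs
    obtain ⟨u, hu⟩ := hsurj z.1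
    obtain ⟨v, hv⟩ := hsurj z.2
    have hu₀ : f.toAlgHom (a₀ - Poly.eval A 0 u) = 0 := by
      rw [map_sub, ← hz₀, sub_eq_zero]
      refine Eq.trans ?_ (Poly.eval_coeff f.toAlgHom.toLinearMap 0 u)
      rw [hu]; rfl
    have hu₁ : f.toAlgHom (a₁ - Poly.eval A 1 u) = 0 := by
      rw [map_sub, ← hz₁, sub_eq_zero]
      refine Eq.trans ?_ (Poly.eval_coeff f.toAlgHom.toLinearMap 1 u)
      rw [hu]; rfl
    -- Linear interpolation corrects the two ends of the lift `u` independently; the corrections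
    -- have coefficients in `ker f`, so the image `z` is unchanged.
    refine ⟨⟨u + (a₀ - Poly.eval A 0 u) ⊗ₜ (1 - Polynomial.X) +
      (a₁ - Poly.eval A 1 u) ⊗ₜ Polynomial.X, v⟩, PathSpace.ext ?_ hv, ?_, ?_⟩
    · change Poly.coeff f.toAlgHom.toLinearMap (u + (a₀ - Poly.eval A 0 u) ⊗ₜ (1 - Polynomial.X) +
        (a₁ - Poly.eval A 1 u) ⊗ₜ Polynomial.X) = z.1
      rw [map_add, map_add, hu, LinearMap.rTensor_tmul, LinearMap.rTensor_tmul,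
        AlgHom.toLinearMap_apply, AlgHom.toLinearMap_apply, hu₀, hu₁, TensorProduct.zero_tmul,
        TensorProduct.zero_tmul, add_zero, add_zero]
    · change Poly.eval A 0 (u + (a₀ - Poly.eval A 0 u) ⊗ₜ (1 - Polynomial.X) +
        (a₁ - Poly.eval A 1 u) ⊗ₜ Polynomial.X) = a₀
      simp
    · change Poly.eval A 1 (u + (a₀ - Poly.eval A 0 u) ⊗ₜ (1 - Polynomial.X) +
        (a₁ - Poly.eval A 1 u) ⊗ₜ Polynomial.X) = a₁
      simp
  -- it remains to solve `d ζ = y - d ξ` in the kernel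
  obtain ⟨ζ, hζ, hζf, hζe⟩ : ∃ ζ : A.path, A.path.d ζ = y - A.path.d ξ ∧
      (pathMap f).toAlgHom ζ = 0 ∧ ∀ c, (A.pathEval c).toAlgHom (y - A.path.d ξ) = 0 →
        (A.pathEval c).toAlgHom ζ = 0 := by
    obtain ⟨s, hs0, hsd⟩ := h.exists_contraction
    set k : A.path := y - A.path.d ξ with hk
    have hkf : (pathMap f).toAlgHom k = 0 := by
      rw [hk, map_sub, (pathMap f).map_d, hξ, hz, sub_self]
    have hkd : A.path.d k = 0 := by rw [hk, map_sub, hy, A.path.d_d, sub_zero]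
    have hk1 : Poly.coeff A.d k.1 = 0 := congrArg PathSpace.fst hkd
    have hk2 : Poly.coeff A.d k.2 + Poly.coeff A.sgn (Poly.deriv A k.1) = 0 :=
      congrArg PathSpace.snd hkd
    have hkf1 : Poly.coeff f.toAlgHom.toLinearMap k.1 = 0 := congrArg PathSpace.fst hkf
    have hkf2 : Poly.coeff f.toAlgHom.toLinearMap k.2 = 0 := congrArg PathSpace.snd hkf
    have hfs : ∀ w : A.Poly, Poly.coeff f.toAlgHom.toLinearMap (Poly.coeff s w) = 0 := by
      intro w
      rw [Poly.coeff_comp, (LinearMap.ext hs0 : f.toAlgHom.toLinearMap ∘ₗ s = 0), Poly.coeff,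
        LinearMap.rTensor_zero, LinearMap.zero_apply]
    have hds : ∀ w : A.Poly, Poly.coeff f.toAlgHom.toLinearMap w = 0 → Poly.coeff A.d w = 0 →
        Poly.coeff A.d (Poly.coeff s w) = w := by
      intro w hw hdw
      have h3 := Poly.coeff_eqOn (f := A.d ∘ₗ s + s ∘ₗ A.d) (g := LinearMap.id)
        (fun a ha => hsd a ha) (Poly.mem_span_ker hs hw)
      rw [Poly.coeff, Poly.coeff, LinearMap.rTensor_id, LinearMap.rTensor_add,
        LinearMap.add_apply, LinearMap.id_apply] at h3
      rw [Poly.coeff_comp]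
      have h4 : (s ∘ₗ A.d).rTensor ℚ[X] w = 0 := by
        have := Poly.coeff_comp s A.d w
        rw [hdw, map_zero] at this
        exact this.symm
      rw [h4, add_zero] at h3
      exact h3
    have hds1 := hds k.1 hkf1 hk1
    -- Applying `s` to the coefficients solves the first coordinate. The error left in the
    -- `dt`-coordinate is again a cocycle over `ker f`, so `s` solves it as well.
    let g : A.Poly := k.2 - Poly.coeff A.sgn (Poly.deriv A (Poly.coeff s k.1))
    have hg1 : Poly.coeff f.toAlgHom.toLinearMap g = 0 := by
      rw [map_sub, hkf2, Poly.coeff_hom_sgn, Poly.coeff_deriv, hfs, map_zero, map_zero, sub_zero]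
    have hg2 : Poly.coeff A.d g = 0 := by
      rw [map_sub, ← neg_neg (Poly.coeff A.d (Poly.coeff A.sgn _)), ← Poly.coeff_sgn_d,
        Poly.coeff_deriv, hds1, sub_neg_eq_add, hk2]
    refine ⟨⟨Poly.coeff s k.1, Poly.coeff s g⟩, PathSpace.ext hds1 ?_,
      PathSpace.ext (hfs _) (hfs _), fun c hc => ?_⟩
    · change Poly.coeff A.d (Poly.coeff s g) +
        Poly.coeff A.sgn (Poly.deriv A (Poly.coeff s k.1)) = k.2
      rw [hds g hg1 hg2, sub_add_cancel]
    -- As `s` acts on coefficients it commutes with evaluation. Hence the correction vanishes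
    -- wherever `y - d ξ` does, in particular at both ends.
    · rw [pathEval_apply] at hc
      change Poly.eval A c (Poly.coeff s k.1) = 0
      rw [Poly.eval_coeff, hc, map_zero]
  refine ⟨ξ + ζ, ?_, ?_, ?_, ?_⟩
  · rw [map_add, hζ, add_sub_cancel]
  · rw [map_add, hξ, hζf, add_zero]
  · rw [map_add, hξ₀, hζe 0, add_zero]
    rw [map_sub, (A.pathEval 0).map_d, hξ₀, h₀, sub_self]
  · rw [map_add, hξ₁, hζe 1, add_zero]
    rw [map_sub, (A.pathEval 1).map_d, hξ₁, h₁, sub_self]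

end DGCA

/-! ### Fibre products and the mapping path factorization -/

namespace DGCA

theorem sum_proj_superset (A : DGCA.{u}) (a : A) :
    ∃ s : Finset ℕ, ∀ t, s ⊆ t → ∑ n ∈ t, A.proj n a = a := by
  classical
  refine ⟨(DirectSum.decompose A.grading a).support, fun t ht => ?_⟩
  refine Eq.trans ?_ (DirectSum.sum_support_decompose A.grading a)
  refine (Finset.sum_subset ht fun n _ hn => ?_).symm
  rw [DFinsupp.notMem_support_iff] at hn
  simp [GradedAlgebra.proj_apply, hn]

section Pullback

variable {X Y Z : DGCA.{u}} (f : X ⟶ Z) (g : Y ⟶ Z)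

/-- The underlying algebra of the fibre product. -/
abbrev pullbackSubalgebra : Subalgebra ℚ (X × Y) :=
  AlgHom.equalizer (f.toAlgHom.comp (AlgHom.fst ℚ X Y)) (g.toAlgHom.comp (AlgHom.snd ℚ X Y))

/-- The underlying space of the fibre product. -/
def PullbackSpace : Type u := pullbackSubalgebra f g

noncomputable instance : Ring (PullbackSpace f g) := inferInstanceAs (Ring (pullbackSubalgebra f g))
noncomputable instance : Algebra ℚ (PullbackSpace f g) :=
  inferInstanceAs (Algebra ℚ (pullbackSubalgebra f g))

/-- The inclusion of the fibre product into the product. -/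
noncomputable def PullbackSpace.val : PullbackSpace f g →ₐ[ℚ] X × Y := (pullbackSubalgebra f g).val

namespace Pullback

variable {f g}

theorem condition (p : PullbackSpace f g) : f.toAlgHom p.1.1 = g.toAlgHom p.1.2 := p.2

variable (f g) in
/-- The first coordinate as a linear map. -/
noncomputable def fstₗ : PullbackSpace f g →ₗ[ℚ] X :=
  LinearMap.fst ℚ X Y ∘ₗ (PullbackSpace.val f g).toLinearMap

variable (f g) in
/-- The second coordinate as a linear map. -/
noncomputable def sndₗ : PullbackSpace f g →ₗ[ℚ] Y :=
  LinearMap.snd ℚ X Y ∘ₗ (PullbackSpace.val f g).toLinearMap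

variable (f g) in
/-- The homogeneous parts of the fibre product. -/
noncomputable def grading (n : ℕ) : Submodule ℚ (PullbackSpace f g) :=
  (X.grading n).comap (fstₗ f g) ⊓ (Y.grading n).comap (sndₗ f g)

/-- Two linear maps that are compatible over `Z` induce a linear map on the fibre product. -/
noncomputable def mapₗ (a : X →ₗ[ℚ] X) (b : Y →ₗ[ℚ] Y)
    (h : ∀ x y, f.toAlgHom x = g.toAlgHom y → f.toAlgHom (a x) = g.toAlgHom (b y)) :
    PullbackSpace f g →ₗ[ℚ] PullbackSpace f g where
  toFun p := ⟨(a p.1.1, b p.1.2), h _ _ (condition p)⟩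
  map_add' _ _ := Subtype.ext (Prod.ext (map_add a _ _) (map_add b _ _))
  map_smul' _ _ := Subtype.ext (Prod.ext (map_smul a _ _) (map_smul b _ _))

variable (f g) in
/-- The projections to the homogeneous parts. -/
noncomputable def projection (n : ℕ) : PullbackSpace f g →ₗ[ℚ] PullbackSpace f g :=
  mapₗ (X.proj n) (Y.proj n) fun x y h => by rw [map_proj, map_proj, h]

theorem ext {p q : PullbackSpace f g} (h₁ : p.1.1 = q.1.1) (h₂ : p.1.2 = q.1.2) : p = q :=
  Subtype.ext (Prod.ext h₁ h₂)

theorem isInternal_grading : DirectSum.IsInternal (grading f g) := by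
  refine DirectSum.isInternal_of_projections _ (projection f g) ?_ ?_ ?_
  · intro n p hp
    exact ext (X.proj_of_mem hp.1) (Y.proj_of_mem hp.2)
  · intro m n hmn p hp
    exact ext (X.proj_of_mem_ne hp.1 hmn.symm) (Y.proj_of_mem_ne hp.2 hmn.symm)
  · rw [eq_top_iff]
    rintro p -
    obtain ⟨s, hs⟩ := X.sum_proj_superset p.1.1
    obtain ⟨t, ht⟩ := Y.sum_proj_superset p.1.2
    have hp : p = ∑ n ∈ s ∪ t, projection f g n p := by
      refine ext ?_ ?_
      · change p.1.1 = fstₗ f g _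
        rw [map_sum]
        exact (hs _ Finset.subset_union_left).symm
      · change p.1.2 = sndₗ f g _
        rw [map_sum]
        exact (ht _ Finset.subset_union_right).symm
    rw [hp]
    exact sum_mem fun n _ => le_iSup (grading f g) n ⟨X.proj_mem n _, Y.proj_mem n _⟩

instance : SetLike.GradedMonoid (grading f g) where
  one_mem := ⟨SetLike.GradedOne.one_mem (A := X.grading), SetLike.GradedOne.one_mem (A := Y.grading)⟩
  mul_mem _ _ _ _ hx hy := ⟨SetLike.GradedMul.mul_mem (A := X.grading) hx.1 hy.1,
    SetLike.GradedMul.mul_mem (A := Y.grading) hx.2 hy.2⟩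

noncomputable instance : GradedAlgebra (grading f g) := isInternal_grading.gradedAlgebra

end Pullback

/-- The fibre product `X ×_Z Y`. -/
noncomputable def pullback : DGCA.{u} where
  carrier := PullbackSpace f g
  grading := Pullback.grading f g
  d := Pullback.mapₗ X.d Y.d fun x y h => by rw [f.map_d, g.map_d, h]
  d_mem n _ hp := ⟨X.d_mem n _ hp.1, Y.d_mem n _ hp.2⟩
  d_d p := Pullback.ext (X.d_d _) (Y.d_d _)
  leibniz n p q hp := by
    rw [neg_one_pow_mul]
    refine Pullback.ext ((X.leibniz n _ _ hp.1).trans ?_) ((Y.leibniz n _ _ hp.2).trans ?_) <;>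
    · rw [neg_one_pow_mul]; rfl
  graded_comm m n p q hp hq := by
    rw [neg_one_pow_mul]
    refine Pullback.ext ((X.graded_comm m n _ _ hp.1 hq.1).trans ?_)
      ((Y.graded_comm m n _ _ hp.2 hq.2).trans ?_) <;>
    · rw [neg_one_pow_mul]; rfl

/-- The first projection of the fibre product. -/
noncomputable def pullbackFst : pullback f g ⟶ X where
  toAlgHom := (AlgHom.fst ℚ X Y).comp (PullbackSpace.val f g)
  map_mem _ _ hp := hp.1
  map_d _ := rfl

/-- The second projection of the fibre product. -/
noncomputable def pullbackSnd : pullback f g ⟶ Y where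
  toAlgHom := (AlgHom.snd ℚ X Y).comp (PullbackSpace.val f g)
  map_mem _ _ hp := hp.2
  map_d _ := rfl

variable {f g}

/-- The universal property of the fibre product. -/
noncomputable def pullbackLift {W : DGCA.{u}} (a : W ⟶ X) (b : W ⟶ Y) (h : a ≫ f = b ≫ g) :
    W ⟶ pullback f g where
  toAlgHom := (a.toAlgHom.prod b.toAlgHom).codRestrict (pullbackSubalgebra f g) fun w =>
    congrArg (fun k : W ⟶ Z => k.toAlgHom w) h
  map_mem n w hw := ⟨a.map_mem n w hw, b.map_mem n w hw⟩
  map_d w := Pullback.ext (a.map_d w) (b.map_d w)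

end Pullback

section Factorization

variable {X Y : DGCA.{u}} (w : X ⟶ Y)

/-- The mapping path object `X ×_Y (Y ⊗ ∧(t, dt))` of a morphism. -/
noncomputable abbrev mappingPath : DGCA.{u} := pullback w (Y.pathEval 0)

/-- The section `x ↦ (x, w x)` of the projection of the mapping path object to `X`. -/
noncomputable def mappingPathSection : X ⟶ mappingPath w :=
  pullbackLift (𝟙 X) (w ≫ Y.pathConst)
    (by rw [Category.id_comp, Category.assoc, pathConst_eval, Category.comp_id])

/-- The projection of the mapping path object to `X`. -/
noncomputable abbrev mappingPathFst : mappingPath w ⟶ X := pullbackFst w (Y.pathEval 0)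

/-- The evaluation at the end point. -/
noncomputable abbrev mappingPathEnd : mappingPath w ⟶ Y :=
  pullbackSnd w (Y.pathEval 0) ≫ Y.pathEval 1

theorem mappingPathSection_fst : mappingPathSection w ≫ mappingPathFst w = 𝟙 X := rfl

theorem mappingPathSection_end : mappingPathSection w ≫ mappingPathEnd w = w := by
  have h : mappingPathSection w ≫ pullbackSnd w (Y.pathEval 0) = w ≫ Y.pathConst := rfl
  rw [← Category.assoc, h, Category.assoc, pathConst_eval, Category.comp_id]

theorem mappingPathFst_surjective : Function.Surjective (mappingPathFst w).toAlgHom :=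
  fun x => ⟨(mappingPathSection w).toAlgHom x, rfl⟩

/-- The kernel consists of the pairs `(0, z)` with `z(0) = 0`, so it is the acyclic kernel of the
evaluation of `Y.path` at `0`. -/
theorem acyclicKernel_mappingPathFst : AcyclicKernel (mappingPathFst w) := by
  intro p hp hdp
  have hp1 : p.1.1 = 0 := hp
  have hdp2 : Y.path.d p.1.2 = 0 := congrArg (fun q : PullbackSpace w (Y.pathEval 0) => q.1.2) hdp
  obtain ⟨z, hz, hdz⟩ := acyclicKernel_pathEval_zero p.1.2
    (by rw [← Pullback.condition p, hp1, map_zero]) hdp2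
  exact ⟨⟨(0, z), by change w.toAlgHom 0 = (Y.pathEval 0).toAlgHom z; rw [hz, map_zero]⟩, rfl,
    Pullback.ext ((map_zero X.d).trans hp1.symm) hdz⟩

theorem mappingPathEnd_surjective : Function.Surjective (mappingPathEnd w).toAlgHom := by
  intro y
  -- The straight path `y t` starts at `0`, so it pairs with `0 : X`, and it ends at `y`.
  let η : Y.path := (⟨y ⊗ₜ Polynomial.X, 0⟩ : Y.PathSpace)
  have h0 : (Y.pathEval 0).toAlgHom η = 0 := by
    change Poly.eval Y 0 (y ⊗ₜ Polynomial.X) = 0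
    simp
  refine ⟨⟨(0, η), by change w.toAlgHom 0 = (Y.pathEval 0).toAlgHom η; rw [h0, map_zero]⟩, ?_⟩
  change Poly.eval Y 1 (y ⊗ₜ Polynomial.X) = y
  simp

variable {w}

/-- Two-out-of-three twice: the section is a quasi-isomorphism because the projection to `X` is one,
and the section followed by the end map is `w`. -/
theorem IsQuasiIso.acyclicKernel_mappingPathEnd (hw : IsQuasiIso w) :
    AcyclicKernel (mappingPathEnd w) := by
  have hfst := (acyclicKernel_mappingPathFst w).isQuasiIso (mappingPathFst_surjective w)
  have hsec : IsQuasiIso (mappingPathSection w) :=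
    hfst.of_comp_right (by rw [mappingPathSection_fst]; exact isQuasiIso_id)
  refine (hsec.of_comp_left ?_).acyclicKernel (mappingPathEnd_surjective w)
  rw [mappingPathSection_end]
  exact hw

end Factorization

end DGCA

/-! ### Obstruction theory for morphisms out of a minimal Sullivan algebra -/

/-- A section over a subspace extends to a section of a surjective linear map. -/
theorem LinearMap.exists_section_extending {M N : Type*} [AddCommGroup M] [Module ℚ M]
    [AddCommGroup N] [Module ℚ N] (π : M →ₗ[ℚ] N) (hπ : Function.Surjective π)
    (U : Submodule ℚ N) (s₀ : U →ₗ[ℚ] M) (hs₀ : ∀ u, π (s₀ u) = u) :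
    ∃ s : N →ₗ[ℚ] M, (∀ x, π (s x) = x) ∧ ∀ u : U, s u = s₀ u := by
  obtain ⟨s', hs'⟩ := π.exists_rightInverse_of_surjective (LinearMap.range_eq_top.2 hπ)
  obtain ⟨r, hr⟩ := U.subtype.exists_leftInverse_of_injective U.ker_subtype
  have hs : ∀ x, π (s' x) = x := LinearMap.congr_fun hs'
  have hru : ∀ u : U, r u = u := LinearMap.congr_fun hr
  -- An arbitrary section `s'` is corrected by its discrepancy with `s₀`, which takes values in `ker
  -- π` and is extended from `U` along the retraction `r`.
  refine ⟨s' + (s₀ - s' ∘ₗ U.subtype) ∘ₗ r, fun x => ?_, fun u => ?_⟩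
  · simp [hs, hs₀]
  · simp [hru]

/-- Maps on the steps of an exhaustive filtration glue. -/
theorem Submodule.exists_glue {M N : Type*} [AddCommGroup M] [Module ℚ M]
    [AddCommGroup N] [Module ℚ N] (F : ℕ → Submodule ℚ M) (hF : Monotone F)
    (f : ℕ → M →ₗ[ℚ] N) (hf : ∀ k, ∀ v ∈ F k, f (k + 1) v = f k v) :
    ∃ g : (⨆ k, F k : Submodule ℚ M) →ₗ[ℚ] N,
      ∀ k, ∀ v : (⨆ k, F k : Submodule ℚ M), (v : M) ∈ F k → g v = f k v := by
  have hle : ∀ i j, i ≤ j → ∀ v ∈ F i, f j v = f i v := by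
    intro i j hij v hv
    induction j, hij using Nat.le_induction with
    | base => rfl
    | succ j hij ih => rw [hf j v (hF hij hv), ih]
  have hagree : ∀ i j, ∀ v, v ∈ F i → v ∈ F j → f i v = f j v := by
    intro i j v hi hj
    rcases le_total i j with h | h
    · exact (hle i j h v hi).symm
    · exact hle j i h v hj
  have hmem : ∀ v : (⨆ k, F k : Submodule ℚ M), ∃ k, (v : M) ∈ F k := fun v =>
    (Submodule.mem_iSup_of_directed F hF.directed_le).1 v.2
  choose κ hκ using hmem
  refine ⟨{ toFun := fun v => f (κ v) v, map_add' := fun v w => ?_, map_smul' := fun c v => ?_ },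
    fun k v hv => hagree _ _ _ (hκ v) hv⟩
  · have hv := hF (le_max_left (κ v) (κ w)) (hκ v)
    have hw := hF (le_max_right (κ v) (κ w)) (hκ w)
    rw [hagree _ _ _ (hκ (v + w)) (add_mem hv hw), hagree _ _ _ (hκ v) hv,
      hagree _ _ _ (hκ w) hw, Submodule.coe_add, map_add]
  · rw [hagree _ _ _ (hκ (c • v)) (Submodule.smul_mem _ c (hκ v)), Submodule.coe_smul, map_smul,
      RingHom.id_apply]

namespace DGCA

variable {A P : DGCA.{u}}

/-- An algebra homomorphism that preserves degrees. -/
def IsGradedHom (h : A →ₐ[ℚ] P) : Prop := ∀ n, ∀ a ∈ A.grading n, h a ∈ P.grading n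

theorem IsGradedHom.map_sgn {h : A →ₐ[ℚ] P} (hh : IsGradedHom h) (a : A) :
    h (A.sgn a) = P.sgn (h a) := by
  have : h.toLinearMap ∘ₗ A.sgn = P.sgn ∘ₗ h.toLinearMap :=
    A.linearMap_ext fun m a ha => by simp [A.sgn_of_mem ha, P.sgn_of_mem (hh m a ha)]
  exact LinearMap.congr_fun this a

/-- Commuting with `d` passes to products by the Leibniz rule; preservation of degrees enters
through the involution in that rule. -/
theorem IsGradedHom.map_d_of_mem_adjoin {h : A →ₐ[ℚ] P} (hh : IsGradedHom h) {X : Set A}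
    (hX : ∀ a ∈ X, h (A.d a) = P.d (h a)) {a : A} (ha : a ∈ Algebra.adjoin ℚ X) :
    h (A.d a) = P.d (h a) := by
  induction ha using Algebra.adjoin_induction with
  | mem a ha => exact hX a ha
  | algebraMap q => rw [d_algebraMap, AlgHom.commutes, d_algebraMap, map_zero]
  | add a b _ _ ha hb => simp only [map_add, ha, hb]
  | mul a b _ _ ha hb => rw [d_mul, map_add, map_mul, map_mul, map_mul, d_mul, ha, hb, hh.map_sgn]

theorem eqOn_adjoin {h h' : A →ₐ[ℚ] P} {X : Set A} (hX : ∀ a ∈ X, h a = h' a) {a : A}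
    (ha : a ∈ Algebra.adjoin ℚ X) : h a = h' a :=
  (Algebra.adjoin_le (S := AlgHom.equalizer h h') hX) ha

end DGCA

namespace MinimalSullivanAlgebra

open DGCA

variable (S : MinimalSullivanAlgebra.{u}) (P : DGCA.{u})

theorem adjoin_V : Algebra.adjoin ℚ (⋃ n, (S.V n : Set S.algebra.obj)) = ⊤ := by
  rw [eq_top_iff]
  rintro a -
  refine S.induction_on (P := fun a => a ∈ Algebra.adjoin ℚ (⋃ n, (S.V n : Set S.algebra.obj)))
    (fun n v => Algebra.subset_adjoin (Set.mem_iUnion.2 ⟨n, v.2⟩))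
    (fun q => Subalgebra.algebraMap_mem _ q) (fun a b => add_mem) (fun a b => mul_mem) a

variable {P}

/-- The universal property of `∧V`. -/
theorem exists_algHom (ℓ : ∀ n, S.V n →ₗ[ℚ] P) (hℓ : ∀ n v, ℓ n v ∈ P.grading n) :
    ∃ h : S.algebra.obj →ₐ[ℚ] P, IsGradedHom (A := S.algebra.obj) h ∧
      ∀ n (v : S.V n), h v = ℓ n v := by
  obtain ⟨e, he⟩ := S.free
  let f : TensorAlgebra ℚ (DirectSum ℕ (fun n => S.V n)) →ₐ[ℚ] P :=
    TensorAlgebra.lift ℚ (DirectSum.toModule ℚ ℕ P ℓ)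
  have hfι : ∀ n (v : S.V n),
      f (TensorAlgebra.ι ℚ (DirectSum.lof ℚ ℕ (fun n => S.V n) n v)) = ℓ n v := by
    intro n v
    rw [TensorAlgebra.lift_ι_apply]
    exact DirectSum.toModule_lof (φ := ℓ) ℚ n v
  have hf : ∀ ⦃x y⦄, FreeGCRel (fun n => S.V n) x y → f x = f y := by
    rintro _ _ ⟨m, n, v, w⟩
    rw [map_mul, map_smul, map_mul, hfι, hfι, P.graded_comm' (hℓ m v) (hℓ n w)]
  let g : FreeGC (fun n => S.V n) →ₐ[ℚ] P := RingQuot.liftAlgHom ℚ ⟨f, hf⟩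
  let h : S.algebra.obj →ₐ[ℚ] P := g.comp e.symm.toAlgHom
  have hv : ∀ n (v : S.V n), h v = ℓ n v := by
    intro n v
    have : e.symm (v : S.algebra.obj) = FreeGC.ι (fun n => S.V n) n v := by
      rw [AlgEquiv.symm_apply_eq, he]
    change g (e.symm (v : S.algebra.obj)) = _
    rw [this]
    exact (RingQuot.liftAlgHom_mkAlgHom_apply ℚ f hf _).trans (hfι n v)
  refine ⟨h, ?_, hv⟩
  -- the homogeneous elements with homogeneous image span a subalgebra
  let U : ℕ → Submodule ℚ S.algebra.obj := fun n =>
    S.algebra.obj.grading n ⊓ (P.grading n).comap h.toLinearMap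
  have hU : ∀ a : S.algebra.obj, a ∈ ⨆ n, U n := by
    refine S.induction_on (P := fun a => a ∈ ⨆ n, U n) ?_ ?_ (fun a b => add_mem) ?_
    · intro n v
      refine le_iSup U n ⟨S.V_le n v.2, ?_⟩
      change h v ∈ P.grading n
      rw [hv]
      exact hℓ n v
    · intro q
      refine le_iSup U 0 ⟨SetLike.algebraMap_mem_graded S.algebra.obj.grading q, ?_⟩
      change h (algebraMap ℚ _ q) ∈ P.grading 0
      rw [AlgHom.commutes]
      exact SetLike.algebraMap_mem_graded P.grading q
    · intro a b ha hb
      induction ha using Submodule.iSup_induction' with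
      | zero => rw [zero_mul]; exact zero_mem _
      | add x x' _ _ h h' => rw [add_mul]; exact add_mem h h'
      | mem m x hx =>
        induction hb using Submodule.iSup_induction' with
        | zero => rw [mul_zero]; exact zero_mem _
        | add y y' _ _ h h' => rw [mul_add]; exact add_mem h h'
        | mem n y hy =>
          refine le_iSup U (m + n) ⟨SetLike.GradedMul.mul_mem hx.1 hy.1, ?_⟩
          change h (x * y) ∈ P.grading (m + n)
          rw [map_mul]
          exact SetLike.GradedMul.mul_mem hx.2 hy.2
  have hproj : ∀ n, ∀ a : S.algebra.obj, h (S.algebra.obj.proj n a) ∈ P.grading n := by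
    intro n a
    have := hU a
    induction this using Submodule.iSup_induction' with
    | zero => rw [map_zero, map_zero]; exact zero_mem _
    | add x y _ _ hx hy => rw [map_add, map_add]; exact add_mem hx hy
    | mem m x hx =>
      by_cases hmn : m = n
      · subst hmn
        rw [S.algebra.obj.proj_of_mem hx.1]
        exact hx.2
      · rw [S.algebra.obj.proj_of_mem_ne hx.1 hmn, map_zero]
        exact zero_mem _
  intro n a ha
  have := hproj n a
  rwa [S.algebra.obj.proj_of_mem ha] at this

variable {S}

/-- `h` is a morphism on the subspaces `U n` with graph in `G`. -/
structure IsPartialLift (G : Subalgebra ℚ (S.algebra.obj × P)) (h : S.algebra.obj →ₐ[ℚ] P)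
    (U : ℕ → Submodule ℚ S.algebra.obj) : Prop where
  graded : IsGradedHom (A := S.algebra.obj) h
  map_d : ∀ n, ∀ v ∈ U n, h (S.algebra.obj.d v) = P.d (h v)
  mem : ∀ n, ∀ v ∈ U n, ((v, h v) : S.algebra.obj × P) ∈ G

theorem mem_of_mem_adjoin {G : Subalgebra ℚ (S.algebra.obj × P)} {h : S.algebra.obj →ₐ[ℚ] P}
    {X : Set S.algebra.obj} (hX : ∀ v ∈ X, ((v, h v) : S.algebra.obj × P) ∈ G)
    {a : S.algebra.obj} (ha : a ∈ Algebra.adjoin ℚ X) : ((a, h a) : S.algebra.obj × P) ∈ G :=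
  (Algebra.adjoin_le (S := G.comap ((AlgHom.id ℚ S.algebra.obj).prod h)) hX) ha

/-- The subalgebra `G` encodes the constraints on the morphism (lying over a given one, having given
ends); a graph that lies in `G` over generators lies in it everywhere. `hG` solves `d x = h (d v)`
within the constraints for one `v`. What remains is to choose the solutions linearly in `v` and to
keep the values already fixed on `U`. -/
theorem IsPartialLift.extend {G : Subalgebra ℚ (S.algebra.obj × P)}
    (hG : ∀ n, ∀ v ∈ S.V n, ∀ y ∈ P.grading (n + 1), P.d y = 0 →
      ((S.algebra.obj.d v, y) : S.algebra.obj × P) ∈ G →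
      ∃ x ∈ P.grading n, P.d x = y ∧ ((v, x) : S.algebra.obj × P) ∈ G)
    {h : S.algebra.obj →ₐ[ℚ] P} {U U' : ℕ → Submodule ℚ S.algebra.obj}
    (hh : IsPartialLift G h U) (hUU' : ∀ n, U n ≤ U' n) (hU' : ∀ n, U' n ≤ S.V n)
    (hd : ∀ n, ∀ v ∈ U' n,
      S.algebra.obj.d v ∈ Algebra.adjoin ℚ (⋃ m, (U m : Set S.algebra.obj))) :
    ∃ h', IsPartialLift G h' U' ∧ ∀ n, ∀ v ∈ U n, h' v = h v := by
  have hX : ∀ a ∈ (⋃ m, (U m : Set S.algebra.obj)), h (S.algebra.obj.d a) = P.d (h a) := by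
    intro a ha
    obtain ⟨m, hm⟩ := Set.mem_iUnion.1 ha
    exact hh.map_d m a hm
  have hXG : ∀ a ∈ (⋃ m, (U m : Set S.algebra.obj)), ((a, h a) : S.algebra.obj × P) ∈ G := by
    intro a ha
    obtain ⟨m, hm⟩ := Set.mem_iUnion.1 ha
    exact hh.mem m a hm
  have key : ∀ n, ∃ ℓ : S.V n →ₗ[ℚ] P, (∀ v, ℓ v ∈ P.grading n) ∧
      (∀ v : S.V n, (v : S.algebra.obj) ∈ U n → ℓ v = h v) ∧
      ∀ v : S.V n, (v : S.algebra.obj) ∈ U' n → P.d (ℓ v) = h (S.algebra.obj.d v) ∧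
        ((v, ℓ v) : S.algebra.obj × P) ∈ G := by
    intro n
    -- The space of pairs `(v, x)` in which `x` is an admissible value at `v`. It surjects onto `U'
    -- n` by `hG`, and `h` provides a section over `U n`; any section extending that one is a linear
    -- choice of values.
    let M : Submodule ℚ (U' n × P) := (P.grading n).comap (LinearMap.snd ℚ (U' n) P) ⊓
      LinearMap.eqLocus (P.d ∘ₗ LinearMap.snd ℚ (U' n) P)
        (h.toLinearMap ∘ₗ S.algebra.obj.d ∘ₗ (U' n).subtype ∘ₗ LinearMap.fst ℚ (U' n) P) ⊓
      (Subalgebra.toSubmodule G).comap ((U' n).subtype.prodMap LinearMap.id)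
    let π : M →ₗ[ℚ] U' n := LinearMap.fst ℚ (U' n) P ∘ₗ M.subtype
    have hπ : Function.Surjective π := by
      intro v
      obtain ⟨x, hx, hdx, hxG⟩ := hG n v (hU' n v.2) (h (S.algebra.obj.d v))
        (hh.graded _ _ (S.algebra.obj.d_mem n v (S.V_le n (hU' n v.2))))
        (by rw [← hh.graded.map_d_of_mem_adjoin hX (hd n v v.2), S.algebra.obj.d_d, map_zero])
        (mem_of_mem_adjoin hXG (hd n v v.2))
      exact ⟨⟨(v, x), ⟨hx, hdx⟩, hxG⟩, rfl⟩
    let U₀ : Submodule ℚ (U' n) := (U n).comap (U' n).subtype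
    let s₀ : U₀ →ₗ[ℚ] M := (U₀.subtype.prod (h.toLinearMap ∘ₗ (U' n).subtype ∘ₗ
      U₀.subtype)).codRestrict M fun v =>
        ⟨⟨hh.graded n _ (S.V_le n (hU' n v.1.2)), (hh.map_d n _ v.2).symm⟩, hh.mem n _ v.2⟩
    obtain ⟨s, hs, hs'⟩ := LinearMap.exists_section_extending (M := M) (N := U' n) π hπ U₀ s₀
      (fun _ => rfl)
    -- An algebra morphism needs values on all of `V n`; away from `U' n` only their degree matters,
    -- so any retraction onto `U' n` will do.
    obtain ⟨r, hr⟩ := (Submodule.inclusion (hU' n)).exists_leftInverse_of_injective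
      (LinearMap.ker_eq_bot.2 (Submodule.inclusion_injective (hU' n)))
    have hrv : ∀ v : S.V n, ∀ hv : (v : S.algebra.obj) ∈ U' n, r v = ⟨v, hv⟩ := fun v hv =>
      LinearMap.congr_fun hr ⟨v, hv⟩
    refine ⟨LinearMap.snd ℚ (U' n) P ∘ₗ M.subtype ∘ₗ s ∘ₗ r, fun v => (s (r v)).2.1.1,
      fun v hv => ?_, fun v hv => ?_⟩
    · have h1 := hs' ⟨⟨v, hUU' n hv⟩, hv⟩
      simp only [LinearMap.comp_apply, hrv v (hUU' n hv)]
      rw [h1]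
      rfl
    · have h1 : ((s ⟨v, hv⟩ : M) : U' n × P).1 = ⟨v, hv⟩ := hs ⟨v, hv⟩
      have h2 : P.d ((s ⟨v, hv⟩ : M) : U' n × P).2 =
        h (S.algebra.obj.d ((s ⟨v, hv⟩ : M) : U' n × P).1) := (s ⟨v, hv⟩).2.1.2
      have h3 : ((((s ⟨v, hv⟩ : M) : U' n × P).1, ((s ⟨v, hv⟩ : M) : U' n × P).2) :
        S.algebra.obj × P) ∈ G := (s ⟨v, hv⟩).2.2
      rw [h1] at h2 h3
      simp only [LinearMap.comp_apply, hrv v hv]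
      exact ⟨h2, h3⟩
  choose ℓ hℓ hℓU hℓU' using key
  obtain ⟨h', hgr, hv⟩ := S.exists_algHom ℓ hℓ
  have hagree : ∀ n, ∀ v ∈ U n, h' v = h v := fun n v hvU =>
    (hv n ⟨v, hU' n (hUU' n hvU)⟩).trans (hℓU n ⟨v, hU' n (hUU' n hvU)⟩ hvU)
  refine ⟨h', ⟨hgr, fun n v hvU => ?_, fun n v hvU => ?_⟩, hagree⟩
  · have h1 := hv n ⟨v, hU' n hvU⟩
    have h2 := (hℓU' n ⟨v, hU' n hvU⟩ hvU).1
    simp only at h1 h2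
    rw [h1, h2]
    refine eqOn_adjoin (fun a ha => ?_) (hd n v hvU)
    obtain ⟨m, hm⟩ := Set.mem_iUnion.1 ha
    exact hagree m a hm
  · have h1 := hv n ⟨v, hU' n hvU⟩
    have h2 := (hℓU' n ⟨v, hU' n hvU⟩ hvU).2
    simp only at h1 h2
    rwa [h1]

/-- Construction of morphisms out of a minimal Sullivan algebra by obstruction theory. -/
theorem exists_hom_graph_le (G : Subalgebra ℚ (S.algebra.obj × P))
    (hG : ∀ n, ∀ v ∈ S.V n, ∀ y ∈ P.grading (n + 1), P.d y = 0 →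
      ((S.algebra.obj.d v, y) : S.algebra.obj × P) ∈ G →
      ∃ x ∈ P.grading n, P.d x = y ∧ ((v, x) : S.algebra.obj × P) ∈ G) :
    ∃ h : S.algebra.obj ⟶ P, ∀ a, ((a, h.toAlgHom a) : S.algebra.obj × P) ∈ G := by
  obtain ⟨F, hmono, hsup, hF0, hFs⟩ := S.nilpotent
  have hFV : ∀ k n, F k n ≤ S.V n := fun k n => by
    rw [← hsup n]
    exact le_iSup (fun k => F k n) k
  obtain ⟨h₀, hh₀⟩ : ∃ h₀ : S.algebra.obj →ₐ[ℚ] P, IsPartialLift G h₀ (F 0) := by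
    -- The morphism killing all generators is a partial lift on the zero subspaces. One extension
    -- then reaches `F 0`, where `d v = 0` lies in every subalgebra.
    obtain ⟨z, hz, -⟩ := S.exists_algHom (P := P) (fun _ => 0) (fun _ _ => zero_mem _)
    have hbot : IsPartialLift G z (fun _ => ⊥) :=
      ⟨hz, by rintro n v rfl; simp, by
        rintro n v rfl
        rw [map_zero]
        exact zero_mem G⟩
    obtain ⟨h', hh', -⟩ := hbot.extend hG (U' := F 0) (fun _ => bot_le) (hFV 0)
      (fun n v hv => by rw [hF0 n v hv]; exact zero_mem _)
    exact ⟨h', hh'⟩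
  have step : ∀ k, ∀ h : {h : S.algebra.obj →ₐ[ℚ] P // IsPartialLift G h (F k)},
      ∃ h' : {h : S.algebra.obj →ₐ[ℚ] P // IsPartialLift G h (F (k + 1))},
        ∀ n, ∀ v ∈ F k n, h'.1 v = h.1 v := by
    rintro k ⟨h, hh⟩
    obtain ⟨h', hh', hag⟩ := hh.extend hG (U' := F (k + 1)) (hmono k.le_succ) (hFV (k + 1))
      (hFs k)
    exact ⟨⟨h', hh'⟩, hag⟩
  choose next hnext using step
  let H : ∀ k, {h : S.algebra.obj →ₐ[ℚ] P // IsPartialLift G h (F k)} := fun k =>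
    Nat.rec ⟨h₀, hh₀⟩ next k
  have hH : ∀ k n, ∀ v ∈ F k n, (H (k + 1)).1 v = (H k).1 v := fun k n v hv =>
    hnext k (H k) n v hv
  have glue : ∀ n, ∃ ℓ : S.V n →ₗ[ℚ] P, ∀ k, ∀ v : S.V n, (v : S.algebra.obj) ∈ F k n →
      ℓ v = (H k).1 v := by
    intro n
    obtain ⟨g, hg⟩ := Submodule.exists_glue (fun k => F k n) (fun i j hij => hmono hij n)
      (fun k => (H k).1.toLinearMap) (fun k v hv => hH k n v hv)
    exact ⟨g ∘ₗ Submodule.inclusion (hsup n).ge, fun k v hv =>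
      hg k (Submodule.inclusion (hsup n).ge v) hv⟩
  choose ℓ hℓ using glue
  have hex : ∀ n, ∀ v ∈ S.V n, ∃ k, v ∈ F k n := fun n v hv => by
    rw [← hsup n] at hv
    exact (Submodule.mem_iSup_of_directed (fun k => F k n)
      (Monotone.directed_le fun i j hij => hmono hij n)).1 hv
  obtain ⟨h, hgr, hv⟩ := S.exists_algHom ℓ (fun n v => by
    obtain ⟨k, hk⟩ := hex n v v.2
    rw [hℓ n k v hk]
    exact (H k).2.graded n _ (S.V_le n v.2))
  have hagree : ∀ k n, ∀ v ∈ F k n, h v = (H k).1 v := fun k n v hvF =>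
    (hv n ⟨v, hFV k n hvF⟩).trans (hℓ n k _ hvF)
  have hd : ∀ a ∈ (⋃ n, (S.V n : Set S.algebra.obj)), h (S.algebra.obj.d a) = P.d (h a) := by
    intro a ha
    obtain ⟨n, hn⟩ := Set.mem_iUnion.1 ha
    obtain ⟨k, hk⟩ := hex n a hn
    -- Raising the index to `k + 1` makes the nilpotence condition `hFs k` available for `a`,
    -- whatever `k` is.
    have hk' := hmono k.le_succ n hk
    rw [hagree _ n a hk', ← (H (k + 1)).2.map_d n a hk']
    refine eqOn_adjoin (fun b hb => ?_) (hFs k n a hk')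
    obtain ⟨m, hm⟩ := Set.mem_iUnion.1 hb
    exact hagree _ m b (hmono k.le_succ m hm)
  have hall : ∀ a, a ∈ Algebra.adjoin ℚ (⋃ n, (S.V n : Set S.algebra.obj)) := fun a => by
    rw [adjoin_V]
    exact Algebra.mem_top
  refine ⟨⟨h, hgr, fun a => hgr.map_d_of_mem_adjoin hd (hall a)⟩, fun a => ?_⟩
  refine mem_of_mem_adjoin (fun b hb => ?_) (hall a)
  obtain ⟨n, hn⟩ := Set.mem_iUnion.1 hb
  obtain ⟨k, hk⟩ := hex n b hn
  rw [hagree k n b hk]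
  exact (H k).2.mem n b hk

end MinimalSullivanAlgebra

/-! ### Homotopy classes of morphisms and their invariance under quasi-isomorphisms -/

namespace MinimalSullivanAlgebra

open DGCA

/-- Right homotopy of morphisms. -/
def Homotopic {A X : DGCA.{u}} (f g : A ⟶ X) : Prop :=
  ∃ H : A ⟶ X.path, H ≫ X.pathEval 0 = f ∧ H ≫ X.pathEval 1 = g

theorem Homotopic.refl {A X : DGCA.{u}} (f : A ⟶ X) : Homotopic f f :=
  ⟨f ≫ X.pathConst, by rw [Category.assoc, pathConst_eval, Category.comp_id],
    by rw [Category.assoc, pathConst_eval, Category.comp_id]⟩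

theorem Homotopic.postcomp {A X Y : DGCA.{u}} {f g : A ⟶ X} (h : Homotopic f g) (w : X ⟶ Y) :
    Homotopic (f ≫ w) (g ≫ w) := by
  obtain ⟨H, rfl, rfl⟩ := h
  exact ⟨H ≫ pathMap w, by rw [Category.assoc, pathMap_eval, Category.assoc],
    by rw [Category.assoc, pathMap_eval, Category.assoc]⟩

theorem Homotopic.precomp {A B X : DGCA.{u}} {f g : B ⟶ X} (h : Homotopic f g) (w : A ⟶ B) :
    Homotopic (w ≫ f) (w ≫ g) := by
  obtain ⟨H, rfl, rfl⟩ := h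
  exact ⟨w ≫ H, by rw [Category.assoc], by rw [Category.assoc]⟩

section Lifting

variable {S : MinimalSullivanAlgebra.{u}} {X Y : DGCA.{u}} {w : X ⟶ Y}

/-- Here `G` is the set of pairs with `f a = w x`. If `x` is any lift of `f v`, then `y - d x` is a
cocycle in the acyclic kernel of `w`, so `x` can be corrected by an element of that kernel. -/
theorem exists_lift (hw : AcyclicKernel w) (hs : Function.Surjective w.toAlgHom)
    (f : S.algebra.obj ⟶ Y) : ∃ f' : S.algebra.obj ⟶ X, f' ≫ w = f := by
  obtain ⟨h, hh⟩ := exists_hom_graph_le (S := S) (P := X)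
    (AlgHom.equalizer (f.toAlgHom.comp (AlgHom.fst ℚ _ X)) (w.toAlgHom.comp (AlgHom.snd ℚ _ X)))
    (by
      intro n v hv y hy hdy hG
      have hG' : f.toAlgHom (S.algebra.obj.d v) = w.toAlgHom y := hG
      obtain ⟨x, hx⟩ := hs (f.toAlgHom v)
      obtain ⟨k, hk, hdk⟩ := hw (y - X.d x)
        (by rw [map_sub, w.map_d, hx, ← hG', f.map_d, sub_self])
        (by rw [map_sub, hdy, X.d_d, sub_zero])
      refine ⟨X.proj n (x + k), X.proj_mem n _, ?_, ?_⟩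
      · rw [← d_proj, map_add, hdk, add_sub_cancel, X.proj_of_mem hy]
      · change f.toAlgHom v = w.toAlgHom (X.proj n (x + k))
        rw [map_proj, map_add, hk, add_zero, hx,
          Y.proj_of_mem (f.map_mem n v (S.V_le n hv))])
  exact ⟨h, DGCA.hom_ext fun a => (hh a).symm⟩

/-- The homotopy downstairs is lifted with both ends prescribed. `G` is the intersection of the
three constraints (image `H`, start `f`, end `g`), and the obstruction is removed by
`AcyclicKernel.path_lift`. -/
theorem homotopic_of_comp (hw : AcyclicKernel w) (hs : Function.Surjective w.toAlgHom)
    {f g : S.algebra.obj ⟶ X} (hfg : Homotopic (f ≫ w) (g ≫ w)) : Homotopic f g := by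
  obtain ⟨H, hH₀, hH₁⟩ := hfg
  have e₀ : ∀ a, (Y.pathEval 0).toAlgHom (H.toAlgHom a) = w.toAlgHom (f.toAlgHom a) := fun a =>
    congrArg (fun k : S.algebra.obj ⟶ Y => k.toAlgHom a) hH₀
  have e₁ : ∀ a, (Y.pathEval 1).toAlgHom (H.toAlgHom a) = w.toAlgHom (g.toAlgHom a) := fun a =>
    congrArg (fun k : S.algebra.obj ⟶ Y => k.toAlgHom a) hH₁
  obtain ⟨h, hh⟩ := exists_hom_graph_le (S := S) (P := X.path)
    (AlgHom.equalizer (H.toAlgHom.comp (AlgHom.fst ℚ _ X.path))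
        ((pathMap w).toAlgHom.comp (AlgHom.snd ℚ _ X.path)) ⊓
      (AlgHom.equalizer (f.toAlgHom.comp (AlgHom.fst ℚ _ X.path))
        ((X.pathEval 0).toAlgHom.comp (AlgHom.snd ℚ _ X.path)) ⊓
      AlgHom.equalizer (g.toAlgHom.comp (AlgHom.fst ℚ _ X.path))
        ((X.pathEval 1).toAlgHom.comp (AlgHom.snd ℚ _ X.path))))
    (by
      rintro n v hv y hy hdy ⟨hG, hG₀, hG₁⟩
      have hG' : H.toAlgHom (S.algebra.obj.d v) = (pathMap w).toAlgHom y := hG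
      have hG₀' : f.toAlgHom (S.algebra.obj.d v) = (X.pathEval 0).toAlgHom y := hG₀
      have hG₁' : g.toAlgHom (S.algebra.obj.d v) = (X.pathEval 1).toAlgHom y := hG₁
      obtain ⟨x, hdx, hx, hx₀, hx₁⟩ := hw.path_lift hs hdy (z := H.toAlgHom v)
        (by rw [← hG', H.map_d]) (a₀ := f.toAlgHom v) (a₁ := g.toAlgHom v)
        (by rw [← hG₀', f.map_d]) (by rw [← hG₁', g.map_d]) (e₀ v) (e₁ v)
      have hvS := S.V_le n hv
      refine ⟨X.path.proj n x, X.path.proj_mem n _, ?_, ?_, ?_, ?_⟩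
      · rw [← d_proj, hdx, X.path.proj_of_mem hy]
      · change H.toAlgHom v = (pathMap w).toAlgHom (X.path.proj n x)
        rw [map_proj, hx, Y.path.proj_of_mem (H.map_mem n v hvS)]
      · change f.toAlgHom v = (X.pathEval 0).toAlgHom (X.path.proj n x)
        rw [map_proj, hx₀, X.proj_of_mem (f.map_mem n v hvS)]
      · change g.toAlgHom v = (X.pathEval 1).toAlgHom (X.path.proj n x)
        rw [map_proj, hx₁, X.proj_of_mem (g.map_mem n v hvS)])
  exact ⟨h, DGCA.hom_ext fun a => (hh a).2.1.symm, DGCA.hom_ext fun a => (hh a).2.2.symm⟩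

end Lifting

/-- Homotopy classes of morphisms out of a fixed algebra. -/
def homotopyClasses (A : DGCA.{u}) : DGCA.{u} ⥤ Type u where
  obj X := Quot (Homotopic (A := A) (X := X))
  map w := TypeCat.ofHom (Quot.map (fun f => f ≫ w) fun _ _ h => h.postcomp w)
  map_id X := by
    ext x
    induction x using Quot.ind
    rfl
  map_comp f g := by
    ext x
    induction x using Quot.ind
    rfl

/-- Precomposition on homotopy classes. -/
def homotopyClassesMap {A B : DGCA.{u}} (f : A ⟶ B) : homotopyClasses B ⟶ homotopyClasses A where
  app X := TypeCat.ofHom (Quot.map (fun g => f ≫ g) fun _ _ h => h.precomp f)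
  naturality X Y w := by
    ext x
    induction x using Quot.ind
    rfl

theorem isIso_homotopyClasses_of_acyclicKernel (S : MinimalSullivanAlgebra.{u}) {X Y : DGCA.{u}}
    {w : X ⟶ Y} (hw : AcyclicKernel w) (hs : Function.Surjective w.toAlgHom) :
    IsIso ((homotopyClasses S.algebra.obj).map w) := by
  rw [isIso_iff_bijective]
  -- `Quot` imposes the equivalence relation generated by `Homotopic`, so an equality of classes is
  -- a zigzag of homotopies. It is lifted link by link, with intermediate morphisms lifted by
  -- `exists_lift`.
  have key : ∀ y y' : S.algebra.obj ⟶ Y, Relation.EqvGen Homotopic y y' →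
      ∀ f f' : S.algebra.obj ⟶ X, f ≫ w = y → f' ≫ w = y' →
        Quot.mk Homotopic f = Quot.mk Homotopic f' := by
    intro y y' h
    induction h with
    | rel y y' h =>
      rintro f f' rfl rfl
      exact Quot.sound (homotopic_of_comp hw hs h)
    | refl y =>
      intro f f' hf hf'
      refine Quot.sound (homotopic_of_comp hw hs ?_)
      rw [hf, hf']
      exact Homotopic.refl y
    | symm y y' _ ih => exact fun f f' hf hf' => (ih f' f hf' hf).symm
    | trans y₁ y₂ y₃ _ _ ih ih' =>
      intro f f' hf hf'
      obtain ⟨m, hm⟩ := exists_lift hw hs y₂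
      exact (ih f m hf hm).trans (ih' m f' hm hf')
  constructor
  · intro p q hpq
    induction p using Quot.ind with | mk f =>
    induction q using Quot.ind with | mk g =>
    exact key _ _ (Quot.eqvGen_exact hpq) f g rfl rfl
  · intro q
    induction q using Quot.ind with | mk f =>
    obtain ⟨f', hf'⟩ := exists_lift hw hs f
    exact ⟨Quot.mk _ f', congrArg (Quot.mk _) hf'⟩

/-- Both maps out of the mapping path object are surjective with acyclic kernel, hence become
invertible. So does the section of the first, and `w` is this section followed by the second. -/
theorem isIso_homotopyClasses (S : MinimalSullivanAlgebra.{u}) {X Y : DGCA.{u}} {w : X ⟶ Y}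
    (hw : IsQuasiIso w) : IsIso ((homotopyClasses S.algebra.obj).map w) := by
  have h1 := isIso_homotopyClasses_of_acyclicKernel S (acyclicKernel_mappingPathFst w)
    (mappingPathFst_surjective w)
  have h2 := isIso_homotopyClasses_of_acyclicKernel S hw.acyclicKernel_mappingPathEnd
    (mappingPathEnd_surjective w)
  have h3 : IsIso ((homotopyClasses S.algebra.obj).map (mappingPathSection w)) := by
    have : IsIso ((homotopyClasses S.algebra.obj).map (mappingPathSection w) ≫
        (homotopyClasses S.algebra.obj).map (mappingPathFst w)) := by
      rw [← Functor.map_comp, mappingPathSection_fst]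
      infer_instance
    exact IsIso.of_isIso_comp_right _ ((homotopyClasses S.algebra.obj).map (mappingPathFst w))
  rw [← mappingPathSection_end w, Functor.map_comp]
  infer_instance

/-! ### Homotopy invariance of the linear part in the simply-connected case -/

section SimplyConnected

variable {S T : MinimalSullivanAlgebra.{u}}

/-- An element generated in degrees at least `2`: its part of degree `2` is linear. -/
theorem exists_sub_algebraMap_mem (A : DGCA.{u}) (U : ℕ → Submodule ℚ A)
    (hU : ∀ n, U n ≤ A.grading n) (h0 : U 0 = ⊥) (h1 : U 1 = ⊥) {a : A}
    (ha : a ∈ Algebra.adjoin ℚ (⋃ n, (U n : Set A))) :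
    ∃ q : ℚ, a - algebraMap ℚ A q ∈ U 2 ⊔ ⨆ n, A.grading (n + 3) := by
  have hle : U 2 ⊔ ⨆ n, A.grading (n + 3) ≤ ⨆ n, A.grading (n + 2) :=
    sup_le ((hU 2).trans (le_iSup (fun n => A.grading (n + 2)) 0))
      (iSup_le fun n => le_iSup (fun n => A.grading (n + 2)) (n + 1))
  have hmul : ∀ x ∈ ⨆ n, A.grading (n + 2), ∀ y ∈ ⨆ n, A.grading (n + 2),
      x * y ∈ ⨆ n, A.grading (n + 3) := by
    intro x hx y hy
    induction hx using Submodule.iSup_induction' with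
    | zero => rw [zero_mul]; exact zero_mem _
    | add x x' _ _ h h' => rw [add_mul]; exact add_mem h h'
    | mem m x hx =>
      induction hy using Submodule.iSup_induction' with
      | zero => rw [mul_zero]; exact zero_mem _
      | add y y' _ _ h h' => rw [mul_add]; exact add_mem h h'
      | mem n y hy =>
        have hxy : x * y ∈ A.grading (m + 2 + (n + 2)) := SetLike.GradedMul.mul_mem hx hy
        rw [show m + 2 + (n + 2) = m + n + 1 + 3 by omega] at hxy
        exact le_iSup (fun n => A.grading (n + 3)) (m + n + 1) hxy
  induction ha using Algebra.adjoin_induction with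
  | mem a ha =>
    refine ⟨0, ?_⟩
    rw [map_zero, sub_zero]
    obtain ⟨n, hn⟩ := Set.mem_iUnion.1 ha
    match n, hn with
    | 0, hn => rw [h0] at hn; rw [(Submodule.mem_bot ℚ).1 hn]; exact zero_mem _
    | 1, hn => rw [h1] at hn; rw [(Submodule.mem_bot ℚ).1 hn]; exact zero_mem _
    | 2, hn => exact Submodule.mem_sup_left hn
    | n + 3, hn =>
      exact Submodule.mem_sup_right (le_iSup (fun n => A.grading (n + 3)) n (hU _ hn))
  | algebraMap q => exact ⟨q, by rw [sub_self]; exact zero_mem _⟩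
  | add a b _ _ ha hb =>
    obtain ⟨p, hp⟩ := ha
    obtain ⟨q, hq⟩ := hb
    exact ⟨p + q, by rw [map_add, add_sub_add_comm]; exact add_mem hp hq⟩
  | mul a b _ _ ha hb =>
    obtain ⟨p, hp⟩ := ha
    obtain ⟨q, hq⟩ := hb
    refine ⟨p * q, ?_⟩
    have : a * b - algebraMap ℚ A (p * q) =
        (a - algebraMap ℚ A p) * (b - algebraMap ℚ A q) + p • (b - algebraMap ℚ A q) +
          q • (a - algebraMap ℚ A p) := by
      simp only [map_mul, Algebra.algebraMap_eq_smul_one, sub_mul, mul_sub, smul_sub,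
        smul_mul_assoc, mul_smul_comm, one_mul, mul_one, smul_smul, mul_comm q p]
      abel
    rw [this]
    exact add_mem (add_mem (Submodule.mem_sup_right (hmul _ (hle hp) _ (hle hq)))
      (Submodule.smul_mem _ _ hq)) (Submodule.smul_mem _ _ hp)

/-- Generators have positive degree, so the elements of degree zero are scalars. -/
theorem d_grading_zero (S : MinimalSullivanAlgebra.{u}) {a : S.algebra.obj}
    (ha : a ∈ S.algebra.obj.grading 0) : S.algebra.obj.d a = 0 := by
  have key : ∀ a : S.algebra.obj, ∃ q : ℚ, S.algebra.obj.proj 0 a = algebraMap ℚ _ q := by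
    refine S.induction_on (P := fun a => ∃ q : ℚ, S.algebra.obj.proj 0 a = algebraMap ℚ _ q)
      ?_ ?_ ?_ ?_
    · exact fun n v => ⟨0, by rw [S.algebra.obj.proj_zero_plus (S.V_le_plus n v.2), map_zero]⟩
    · exact fun q => ⟨q, S.algebra.obj.proj_of_mem
        (SetLike.algebraMap_mem_graded S.algebra.obj.grading q)⟩
    · rintro a b ⟨p, hp⟩ ⟨q, hq⟩
      exact ⟨p + q, by rw [map_add, hp, hq, map_add]⟩
    · rintro a b ⟨p, hp⟩ ⟨q, hq⟩
      exact ⟨p * q, ((GradedRing.projZeroRingHom S.algebra.obj.grading).map_mul a b).trans (by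
        rw [map_mul]
        exact congrArg₂ (· * ·) hp hq)⟩
  obtain ⟨q, hq⟩ := key a
  rw [S.algebra.obj.proj_of_mem ha] at hq
  rw [hq, d_algebraMap]

/-- A simply connected minimal Sullivan algebra has no elements of degree one. -/
theorem grading_one_eq_bot (hS : S.algebra.obj.IsSimplyConnected) :
    S.algebra.obj.grading 1 = ⊥ := by
  -- As `H¹ = 0`, a cocycle of degree one is a coboundary, and `d` vanishes in degree zero.
  have hcocycle : ∀ x ∈ S.algebra.obj.grading 1, S.algebra.obj.d x = 0 → x = 0 := by
    intro x hx hdx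
    have hsub := hS.2
    have h0 : (Submodule.Quotient.mk (p := S.algebra.obj.coboundaries 1) ⟨x, hdx, hx⟩) = 0 :=
      Subsingleton.elim _ _
    obtain ⟨y, hy⟩ : x ∈ LinearMap.range S.algebra.obj.d :=
      (Submodule.Quotient.mk_eq_zero (S.algebra.obj.coboundaries 1)).1 h0
    rw [← S.algebra.obj.proj_of_mem hx, ← hy, d_proj, S.d_grading_zero (proj_mem _ 0 y)]
  have hproj : ∀ {U : ℕ → Submodule ℚ S.algebra.obj}, (∀ n, U n ≤ S.algebra.obj.grading n) →
      ∀ {z}, z ∈ U 2 ⊔ ⨆ n, S.algebra.obj.grading (n + 3) →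
        S.algebra.obj.proj 1 z = 0 ∧ S.algebra.obj.proj 2 z ∈ U 2 := by
    intro U hU z hz
    obtain ⟨v, hv, j, hj, rfl⟩ := Submodule.mem_sup.1 hz
    have hj' : (⨆ n, S.algebra.obj.grading (n + 3)) ≤
        LinearMap.ker (S.algebra.obj.proj 1) ⊓ LinearMap.ker (S.algebra.obj.proj 2) :=
      iSup_le fun n y hy => ⟨S.algebra.obj.proj_of_mem_ne hy (by omega),
        S.algebra.obj.proj_of_mem_ne hy (by omega)⟩
    have h1 : S.algebra.obj.proj 1 j = 0 := (hj' hj).1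
    have h2 : S.algebra.obj.proj 2 j = 0 := (hj' hj).2
    rw [map_add, map_add, h1, h2, S.algebra.obj.proj_of_mem (hU 2 hv),
      S.algebra.obj.proj_of_mem_ne (hU 2 hv) (by omega), add_zero, add_zero]
    exact ⟨rfl, hv⟩
  have hconst : ∀ q : ℚ, ∀ n, n ≠ 0 → S.algebra.obj.proj n (algebraMap ℚ _ q) = 0 := fun q n hn =>
    S.algebra.obj.proj_of_mem_ne (SetLike.algebraMap_mem_graded S.algebra.obj.grading q) hn.symm
  have hlin : ∀ x ∈ S.V 2, x ∈ S.algebra.obj.plus * S.algebra.obj.plus → x = 0 := by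
    intro x hx hx'
    have h0 : S.toIndec 2 ⟨x, hx⟩ = 0 :=
      (Submodule.Quotient.mk_eq_zero (x := Submodule.inclusion
        (le_inf (S.V_le 2) (S.V_le_plus 2)) ⟨x, hx⟩) _).2 hx'
    exact congrArg Subtype.val ((S.toIndec_bijective 2).1 (h0.trans (map_zero _).symm))
  obtain ⟨F, hmono, hsup, hF0, hFs⟩ := S.nilpotent
  have hFV : ∀ k n, F k n ≤ S.V n := fun k n => by
    rw [← hsup n]
    exact le_iSup (fun k => F k n) k
  -- If `F k` has nothing in degree one, the subalgebra it generates is linear in degree two. So for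
  -- `v` in `F (k + 1) 1` the element `d v` is both a generator in `V 2` and, by minimality,
  -- decomposable. Hence `d v = 0`, and `v = 0` by `hcocycle`.
  have hF1 : ∀ k, F k 1 = ⊥ := by
    intro k
    induction k with
    | zero =>
      rw [eq_bot_iff]
      exact fun v hv => hcocycle v (S.V_le 1 (hFV 0 1 hv)) (hF0 1 v hv)
    | succ k ih =>
      rw [eq_bot_iff]
      intro v hv
      have hv1 := S.V_le 1 (hFV _ 1 hv)
      have hUle : ∀ n, F k n ≤ S.algebra.obj.grading n := fun n => (hFV k n).trans (S.V_le n)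
      obtain ⟨q, hq⟩ := exists_sub_algebraMap_mem S.algebra.obj (F k) hUle
        (by rw [eq_bot_iff, ← S.V_zero]; exact hFV k 0) ih (hFs k 1 v hv)
      have h2 := (hproj hUle hq).2
      rw [map_sub, hconst q 2 (by omega), sub_zero,
        S.algebra.obj.proj_of_mem (S.algebra.obj.d_mem 1 v hv1)] at h2
      exact hcocycle v hv1 (hlin _ (hFV k 2 h2) (S.minimal v))
  have hV1 : S.V 1 = ⊥ := by
    rw [← hsup 1]
    simp only [hF1, iSup_bot]
  rw [eq_bot_iff]
  intro a ha
  obtain ⟨q, hq⟩ := exists_sub_algebraMap_mem S.algebra.obj S.V S.V_le S.V_zero hV1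
    (a := a) (by rw [adjoin_V]; exact Algebra.mem_top)
  have h1 := (hproj S.V_le hq).1
  rwa [map_sub, hconst q 1 (by omega), sub_zero, S.algebra.obj.proj_of_mem ha] at h1

theorem sgn_mem_plus (A : DGCA.{u}) {a : A} (ha : a ∈ A.plus) : A.sgn a ∈ A.plus := by
  have h : A.plus ≤ A.plus.comap A.sgn := iSup_le fun n x hx => by
    rw [Submodule.mem_comap, A.sgn_of_mem hx]
    exact Submodule.smul_mem _ _ (le_iSup (fun n => A.grading (n + 1)) n hx)
  exact h ha

theorem sgn_mem_plus_mul_plus (A : DGCA.{u}) {a : A} (ha : a ∈ A.plus * A.plus) :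
    A.sgn a ∈ A.plus * A.plus := by
  have h : A.plus * A.plus ≤ (A.plus * A.plus).comap A.sgn := by
    rw [Submodule.mul_le]
    intro x hx y hy
    rw [Submodule.mem_comap, sgn_mul]
    exact Submodule.mul_mem_mul (sgn_mem_plus A hx) (sgn_mem_plus A hy)
  exact h ha

/-- Homotopic morphisms out of a simply connected algebra agree modulo decomposables. -/
theorem Homotopic.sub_mem (hS : S.algebra.obj.IsSimplyConnected)
    {f g : S.algebra.obj ⟶ T.algebra.obj} (h : Homotopic f g) (a : S.algebra.obj) :
    g.toAlgHom a - f.toAlgHom a ∈ T.algebra.obj.plus * T.algebra.obj.plus := by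
  obtain ⟨H, rfl, rfl⟩ := h
  -- A `dt`-coefficient of degree zero could come only from an element of degree one, and there is
  -- none except zero.
  have hplus : ∀ x ∈ S.algebra.obj.plus,
      (H.toAlgHom x : T.algebra.obj.PathSpace).1 ∈ Poly.span T.algebra.obj.plus ∧
      (H.toAlgHom x : T.algebra.obj.PathSpace).2 ∈ Poly.span T.algebra.obj.plus := by
    have hle : S.algebra.obj.plus ≤
        ((Poly.span T.algebra.obj.plus).comap (PathSpace.fstₗ (A := T.algebra.obj)) ⊓
          (Poly.span T.algebra.obj.plus).comap (PathSpace.sndₗ (A := T.algebra.obj))).comap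
            H.toAlgHom.toLinearMap := by
      refine iSup_le fun n x hx => ?_
      have hgr : ∀ n, T.algebra.obj.grading (n + 1) ≤ T.algebra.obj.plus :=
        fun n => le_iSup (fun n => T.algebra.obj.grading (n + 1)) n
      cases n with
      | zero =>
        rw [zero_add, grading_one_eq_bot hS, Submodule.mem_bot] at hx
        rw [hx]
        exact zero_mem _
      | succ n =>
        have hHx := H.map_mem _ x hx
        exact ⟨Poly.span_mono (hgr (n + 1)) (PathSpace.fst_mem hHx),
          Poly.span_mono (hgr n) (PathSpace.snd_mem hHx)⟩
    exact fun x hx => hle hx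
  have hprod : ∀ x ∈ S.algebra.obj.plus * S.algebra.obj.plus,
      (H.toAlgHom x : T.algebra.obj.PathSpace).2 ∈
        Poly.span (T.algebra.obj.plus * T.algebra.obj.plus) := by
    have hle : S.algebra.obj.plus * S.algebra.obj.plus ≤
        ((Poly.span (T.algebra.obj.plus * T.algebra.obj.plus)).comap
          (PathSpace.sndₗ (A := T.algebra.obj))).comap H.toAlgHom.toLinearMap := by
      rw [Submodule.mul_le]
      intro x hx y hy
      change (H.toAlgHom (x * y) : T.algebra.obj.PathSpace).2 ∈
        Poly.span (T.algebra.obj.plus * T.algebra.obj.plus)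
      rw [map_mul]
      refine add_mem (Poly.mul_mem_span (fun a ha b hb => Submodule.mul_mem_mul ha hb)
        (hplus x hx).1 (hplus y hy).2) ?_
      exact Poly.mul_mem_span (fun a ha b hb => Submodule.mul_mem_mul ha hb) (hplus x hx).2
        (Poly.coeff_mem_span (fun a ha => sgn_mem_plus _ ha) (hplus y hy).1)
    exact fun x hx => hle hx
  have hsgn : ∀ {z : T.algebra.obj.Poly},
      z ∈ Poly.span (T.algebra.obj.plus * T.algebra.obj.plus) →
      Poly.coeff T.algebra.obj.sgn z ∈ Poly.span (T.algebra.obj.plus * T.algebra.obj.plus) :=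
    Poly.coeff_mem_span fun a ha => sgn_mem_plus_mul_plus _ ha
  let z : T.algebra.obj.PathSpace := H.toAlgHom a
  -- The left side is the `dt`-coefficient of `d (H a) = H (d a)`, and `d a` is decomposable.
  -- Minimality of `T` disposes of the first summand, leaving the derivative of `z.1`.
  have h1 : Poly.coeff T.algebra.obj.d z.2 +
      Poly.coeff T.algebra.obj.sgn (Poly.deriv T.algebra.obj z.1) ∈
        Poly.span (T.algebra.obj.plus * T.algebra.obj.plus) := by
    have := hprod _ (S.minimal a)
    rw [H.map_d] at this
    exact this
  have htop : z.2 ∈ Poly.span (⊤ : Submodule ℚ T.algebra.obj) := by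
    refine Poly.mem_span_top z.2
  have h2 : Poly.coeff T.algebra.obj.d z.2 ∈
      Poly.span (T.algebra.obj.plus * T.algebra.obj.plus) :=
    Poly.coeff_mem_span (fun b _ => T.minimal b) htop
  have h3 := hsgn ((Submodule.add_mem_iff_right _ h2).1 h1)
  rw [Poly.coeff_sgn_sgn] at h3
  change Poly.eval T.algebra.obj 1 z.1 - Poly.eval T.algebra.obj 0 z.1 ∈ _
  rw [Poly.eval_one_sub_eval_zero]
  exact Poly.eval_mem 1 (Poly.integral_mem_span h3)

end SimplyConnected

end MinimalSullivanAlgebra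

/-! ### From interleavings in the homotopy category to maps of generators -/

theorem Interleaved.comp {C D : Type*} [Category C] [Category D] {F G : Persistent C} {δ : ℝ≥0}
    (h : Interleaved F G δ) (K : C ⥤ D) : Interleaved (F ⋙ K) (G ⋙ K) δ := by
  obtain ⟨φ, ψ, h1, h2, h3, h4⟩ := h
  refine ⟨fun t => K.map (φ t), fun t => K.map (ψ t), fun t s hts => ?_, fun t s hts => ?_,
    fun t => ?_, fun t => ?_⟩
  · simp only [Functor.comp_map, ← K.map_comp, h1]
  · simp only [Functor.comp_map, ← K.map_comp, h2]
  · exact (K.map_comp _ _).symm.trans (congrArg K.map (h3 t))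
  · exact (K.map_comp _ _).symm.trans (congrArg K.map (h4 t))

theorem interleavingDist_le_of_interleaved {C D : Type*} [Category C] [Category D]
    {F G : Persistent C} {F' G' : Persistent D}
    (h : ∀ δ, Interleaved F G δ → Interleaved F' G' δ) :
    interleavingDist F' G' ≤ interleavingDist F G :=
  le_iInf₂ fun δ hδ => iInf₂_le δ (h δ hδ)

namespace CDGA

theorem quasiIso.isQuasiIso {X Y : CDGA.{u}} {w : X ⟶ Y} (hw : quasiIso w) :
    DGCA.IsQuasiIso w.hom := by
  refine DGCA.isQuasiIso_of_bijective _ fun n => ?_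
  have h : IsIso (H.map w) := hw
  let i := inv (H.map w)
  have h1 : H.map w ≫ i = 𝟙 _ := IsIso.hom_inv_id _
  have h2 : i ≫ H.map w = 𝟙 _ := IsIso.inv_hom_id _
  refine Function.bijective_iff_has_inverse.2 ⟨(i n).hom, fun x => ?_, fun x => ?_⟩
  · exact LinearMap.congr_fun (congrArg ModuleCat.Hom.hom (congrFun h1 n)) x
  · exact LinearMap.congr_fun (congrArg ModuleCat.Hom.hom (congrFun h2 n)) x

end CDGA

namespace MinimalSullivanAlgebra

open DGCA

theorem homotopyClasses_inverts (S : MinimalSullivanAlgebra.{u}) :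
    CDGA.quasiIso.IsInvertedBy (DGCA.IsPathConnected.ι ⋙ homotopyClasses S.algebra.obj) :=
  fun _ _ _ hw => isIso_homotopyClasses S (CDGA.quasiIso.isQuasiIso hw)

/-- Homotopy classes of morphisms out of `S`, as a functor on the homotopy category. -/
noncomputable def hoClasses (S : MinimalSullivanAlgebra.{u}) : HoCDGA.{u} ⥤ Type u :=
  Localization.lift _ S.homotopyClasses_inverts CDGA.toHo

/-- The comparison isomorphism with the functor before localization. -/
noncomputable def hoClassesIso (S : MinimalSullivanAlgebra.{u}) :
    CDGA.toHo ⋙ S.hoClasses ≅ DGCA.IsPathConnected.ι ⋙ homotopyClasses S.algebra.obj :=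
  Localization.fac _ S.homotopyClasses_inverts CDGA.toHo

variable {S T : MinimalSullivanAlgebra.{u}}

/-- The homotopy class represented by a morphism in the homotopy category. -/
noncomputable def rep {X : CDGA.{u}} (α : CDGA.toHo.obj S.algebra ⟶ CDGA.toHo.obj X) :
    Quot (Homotopic (A := S.algebra.obj) (X := X.obj)) :=
  S.hoClassesIso.hom.app X (S.hoClasses.map α (S.hoClassesIso.inv.app S.algebra
    (Quot.mk Homotopic (𝟙 S.algebra.obj))))

/-- Naturality of the comparison isomorphism along `f`, evaluated at the class of the identity. -/
theorem rep_map {X : CDGA.{u}} (f : S.algebra ⟶ X) :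
    rep (CDGA.toHo.map f) = Quot.mk Homotopic f.hom := by
  have h := ConcreteCategory.congr_hom (S.hoClassesIso.inv.naturality f)
    (Quot.mk Homotopic (𝟙 S.algebra.obj))
  have h' : S.hoClassesIso.inv.app X (Quot.mk Homotopic f.hom) =
      S.hoClasses.map (CDGA.toHo.map f) (S.hoClassesIso.inv.app S.algebra
        (Quot.mk Homotopic (𝟙 S.algebra.obj))) := h
  rw [rep, ← h']
  exact ConcreteCategory.congr_hom (S.hoClassesIso.inv_hom_id_app X) _

/-- Precomposition with `f` is a natural transformation `[T, -] ⟶ [S, -]`, which descends to a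
transformation `σ` over `HoCDGA`. It sends the class of the identity of `T` to the element
determined by `α`; naturality of `σ` along `β` then computes `rep (α ≫ β)`. -/
theorem rep_comp {X : CDGA.{u}} {α : CDGA.toHo.obj S.algebra ⟶ CDGA.toHo.obj T.algebra}
    {β : CDGA.toHo.obj T.algebra ⟶ CDGA.toHo.obj X} {f : S.algebra.obj ⟶ T.algebra.obj}
    {g : T.algebra.obj ⟶ X.obj} (hf : rep α = Quot.mk Homotopic f)
    (hg : rep β = Quot.mk Homotopic g) : rep (α ≫ β) = Quot.mk Homotopic (f ≫ g) := by
  let τ : DGCA.IsPathConnected.ι ⋙ homotopyClasses T.algebra.obj ⟶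
      DGCA.IsPathConnected.ι ⋙ homotopyClasses S.algebra.obj :=
    Functor.whiskerLeft _ (homotopyClassesMap f)
  obtain ⟨σ, hσ⟩ : ∃ σ : T.hoClasses ⟶ S.hoClasses, ∀ Y : CDGA.{u},
      σ.app (CDGA.toHo.obj Y) =
        T.hoClassesIso.hom.app Y ≫ τ.app Y ≫ S.hoClassesIso.inv.app Y := by
    let _ : Localization.Lifting CDGA.toHo CDGA.quasiIso.{u} _ T.hoClasses := ⟨T.hoClassesIso⟩
    let _ : Localization.Lifting CDGA.toHo CDGA.quasiIso.{u} _ S.hoClasses := ⟨S.hoClassesIso⟩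
    exact ⟨Localization.liftNatTrans CDGA.toHo CDGA.quasiIso _ _ _ _ τ,
      fun Y => Localization.liftNatTrans_app CDGA.toHo CDGA.quasiIso _ _ _ _ τ Y⟩
  let x := T.hoClassesIso.inv.app T.algebra (Quot.mk Homotopic (𝟙 T.algebra.obj))
  have hS : ∀ (Y : CDGA.{u}) z, S.hoClassesIso.inv.app Y (S.hoClassesIso.hom.app Y z) = z :=
    fun Y z => ConcreteCategory.congr_hom (S.hoClassesIso.hom_inv_id_app Y) z
  have hS' : ∀ (Y : CDGA.{u}) z, S.hoClassesIso.hom.app Y (S.hoClassesIso.inv.app Y z) = z :=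
    fun Y z => ConcreteCategory.congr_hom (S.hoClassesIso.inv_hom_id_app Y) z
  have hT' : ∀ (Y : CDGA.{u}) z, T.hoClassesIso.hom.app Y (T.hoClassesIso.inv.app Y z) = z :=
    fun Y z => ConcreteCategory.congr_hom (T.hoClassesIso.inv_hom_id_app Y) z
  have hσ' : ∀ (Y : CDGA.{u}) z, σ.app (CDGA.toHo.obj Y) z =
      S.hoClassesIso.inv.app Y (τ.app Y (T.hoClassesIso.hom.app Y z)) := fun Y z => by
    rw [hσ]; rfl
  have hσx : σ.app (CDGA.toHo.obj T.algebra) x =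
      S.hoClasses.map α (S.hoClassesIso.inv.app S.algebra
        (Quot.mk Homotopic (𝟙 S.algebra.obj))) :=
    (hσ' _ x).trans ((congrArg (fun z => S.hoClassesIso.inv.app T.algebra (τ.app T.algebra z))
      (hT' T.algebra _)).trans ((congrArg (S.hoClassesIso.inv.app T.algebra) hf.symm).trans
        (hS T.algebra _)))
  have hnat : σ.app (CDGA.toHo.obj X) (T.hoClasses.map β x) =
      S.hoClasses.map β (σ.app (CDGA.toHo.obj T.algebra) x) :=
    ConcreteCategory.congr_hom (σ.naturality β) x
  have hcomp : ∀ z, S.hoClasses.map (α ≫ β) z = S.hoClasses.map β (S.hoClasses.map α z) :=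
    fun z => ConcreteCategory.congr_hom (S.hoClasses.map_comp α β) z
  rw [rep, hcomp, ← hσx, ← hnat, hσ', hS']
  exact congrArg (τ.app X) hg

/-- A morphism of the underlying algebras as a morphism of minimal Sullivan algebras. -/
def homMk (f : S.algebra.obj ⟶ T.algebra.obj) : S ⟶ T :=
  InducedCategory.homMk (ObjectProperty.homMk f)

/-- By `Homotopic.sub_mem` the two morphisms induce the same map on indecomposables, so
`hoLinearPart` is well defined on homotopy classes. -/
theorem generators_map_homMk_eq (hS : S.algebra.obj.IsSimplyConnected)
    {f g : S.algebra.obj ⟶ T.algebra.obj} (h : Homotopic f g) :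
    generators.map (homMk f) = generators.map (homMk g) := by
  funext n
  refine ModuleCat.hom_ext (LinearMap.ext fun v => ?_)
  refine congrArg (T.indecEquiv n).symm ?_
  refine ((Submodule.Quotient.eq _).2 ?_).symm
  exact h.sub_mem hS (show S.V n from v).1

/-- The map of generators induced by a morphism in the homotopy category. -/
noncomputable def hoLinearPart (hS : S.algebra.obj.IsSimplyConnected)
    (α : CDGA.toHo.obj S.algebra ⟶ CDGA.toHo.obj T.algebra) :
    generators.obj S ⟶ generators.obj T :=
  Quot.lift (fun f => generators.map (homMk f)) (fun _ _ h => generators_map_homMk_eq hS h) (rep α)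

theorem hoLinearPart_map (hS : S.algebra.obj.IsSimplyConnected) (f : S ⟶ T) :
    hoLinearPart hS (CDGA.toHo.map (toCDGA.map f)) = generators.map f := by
  have h := rep_map (toCDGA.map f)
  unfold hoLinearPart
  erw [h]
  rfl

theorem hoLinearPart_comp {U : MinimalSullivanAlgebra.{u}} (hS : S.algebra.obj.IsSimplyConnected)
    (hT : T.algebra.obj.IsSimplyConnected)
    (α : CDGA.toHo.obj S.algebra ⟶ CDGA.toHo.obj T.algebra)
    (β : CDGA.toHo.obj T.algebra ⟶ CDGA.toHo.obj U.algebra) :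
    hoLinearPart hS (α ≫ β) = hoLinearPart hS α ≫ hoLinearPart hT β := by
  obtain ⟨f, hf⟩ := Quot.exists_rep (rep α)
  obtain ⟨g, hg⟩ := Quot.exists_rep (rep β)
  have h := rep_comp hf.symm hg.symm
  unfold hoLinearPart
  rw [h, ← hf, ← hg]
  exact generators.map_comp (homMk f) (homMk g)

end MinimalSullivanAlgebra

/-! ### The two inequalities -/

/-- Lower bounds for the interleaving distance in the homotopy category of path-connected CDGAs. -/
theorem theorem1p3 :
    (∀ A B : Persistent CDGA.{u},
      interleavingDist (A ⋙ CDGA.H) (B ⋙ CDGA.H) ≤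
        interleavingDist (A ⋙ CDGA.toHo) (B ⋙ CDGA.toHo)) ∧
    (∀ M N : Persistent MinimalSullivanAlgebra.{u},
      (∀ t, (M.obj t).algebra.obj.IsSimplyConnected) →
      (∀ t, (N.obj t).algebra.obj.IsSimplyConnected) →
      interleavingDist (M ⋙ MinimalSullivanAlgebra.generators)
          (N ⋙ MinimalSullivanAlgebra.generators) ≤
        interleavingDist (M ⋙ MinimalSullivanAlgebra.toCDGA ⋙ CDGA.toHo)
          (N ⋙ MinimalSullivanAlgebra.toCDGA ⋙ CDGA.toHo)) := by
  constructor
  · intro A B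
    refine interleavingDist_le_of_interleaved fun δ h => ?_
    have hH : CDGA.quasiIso.IsInvertedBy CDGA.H.{u} := fun _ _ _ hw => hw
    have h' := h.comp (Localization.Construction.lift CDGA.H hH)
    rwa [Functor.assoc, Functor.assoc, Localization.Construction.fac] at h'
  · intro M N hM hN
    refine interleavingDist_le_of_interleaved fun δ h => ?_
    obtain ⟨φ, ψ, h1, h2, h3, h4⟩ := h
    -- `hoLinearPart` behaves like a functor on the objects that occur. Applied to each interleaving
    -- identity, it splits composites and turns the images of structure maps into their linear
    -- parts.
    refine ⟨fun t => MinimalSullivanAlgebra.hoLinearPart (hM t) (φ t),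
      fun t => MinimalSullivanAlgebra.hoLinearPart (hN t) (ψ t), fun t s hts => ?_,
      fun t s hts => ?_, fun t => ?_, fun t => ?_⟩
    · have := congrArg (MinimalSullivanAlgebra.hoLinearPart (hM t)) (h1 t s hts)
      simp only [Functor.comp_map] at this ⊢
      erw [MinimalSullivanAlgebra.hoLinearPart_comp (hM t) (hM s),
        MinimalSullivanAlgebra.hoLinearPart_comp (hM t) (hN _),
        MinimalSullivanAlgebra.hoLinearPart_map, MinimalSullivanAlgebra.hoLinearPart_map] at this
      exact this
    · have := congrArg (MinimalSullivanAlgebra.hoLinearPart (hN t)) (h2 t s hts)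
      simp only [Functor.comp_map] at this ⊢
      erw [MinimalSullivanAlgebra.hoLinearPart_comp (hN t) (hN s),
        MinimalSullivanAlgebra.hoLinearPart_comp (hN t) (hM _),
        MinimalSullivanAlgebra.hoLinearPart_map, MinimalSullivanAlgebra.hoLinearPart_map] at this
      exact this
    · have := congrArg (MinimalSullivanAlgebra.hoLinearPart (hM t)) (h3 t)
      simp only [Functor.comp_map] at this ⊢
      erw [MinimalSullivanAlgebra.hoLinearPart_comp (hM t) (hN _),
        MinimalSullivanAlgebra.hoLinearPart_map] at this
      exact this
    · have := congrArg (MinimalSullivanAlgebra.hoLinearPart (hN t)) (h4 t)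
      simp only [Functor.comp_map] at this ⊢
      erw [MinimalSullivanAlgebra.hoLinearPart_comp (hN t) (hM _),
        MinimalSullivanAlgebra.hoLinearPart_map] at this
      exact this
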